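/- Let $d\ge 0$ be an integer, let $\mathbb F_d^*$ be the free semigroup on $d$ generators with unit $\varnothing$, let $|w|$ denote the length of a word $w$, and let $\mathbb F_d^{*0}=\mathbb F_d^*\cup\{0\}$ be obtained by adjoining a zero element. On $\ell^2(\mathbb F_d^*)$ with orthonormal basis $\{\xi_w\}$ put $L_u\xi_w=\xi_{uw}$ for $u\in\mathbb F_d^*$, and $L_0=0$. Let $\mathcal L_d$ be the WOT-closed unital algebra generated by $\{L_u: u\in\mathbb F_d^*\}$, and let $\Delta$ be its comultiplication, the weak*-continuous unital homomorphism from $\mathcal L_d$ into the weak*-closed tensor product $\mathcal L_d\overline\otimes\mathcal L_d\subset B(\ell^2(\mathbb F_d^*)\otimes\ell^2(\mathbb F_d^*))$ with $\Delta(L_w)=L_w\otimes L_w$. Let $\mathcal J$ be a homogeneous Hopf ideal of $\mathcal L_d$, that is, a WOT-closed two-sided ideal of $\mathcal L_d$ which is a coideal, $$\Delta(\mathcal J)\subseteq\overline{\mathcal J\otimes\mathcal L_d+\mathcal L_d\otimes\mathcal J}^{\,w^*},$$ and which is homogeneous: $\mathcal J$ is the WOT-closed linear span of the elements of $\mathcal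 J$ of the form $\sum_{|w|=n}a_wL_w$, $n\ge 0$. Let $\sim$ be the semigroup congruence on $\mathbb F_d^{*0}$ given by $u\sim v$ if and only if $L_u-L_v\in\mathcal J$, let $S=\mathbb F_d^{*0}/\!\sim$, let $\dot 0\in S$ be the class of $0$, let $S_0=S\setminus\{\dot 0\}$, and for $s\in S$ let $[s]\subset\mathbb F_d^{*0}$ be the corresponding equivalence class. Then $[s]$ is finite for every $s\in S_0$. Let $\mathcal H[S]$ be the Hilbert space with orthogonal basis $\{x_s:s\in S_0\}$ and $$(x_s,x_t)=\delta_{s,t}\,\frac1{|[s]|},\qquad s,t\in S_0,$$ put $x_{\dot 0}=0$, let $L_s$, $s\in S$, be the bounded operators on $\mathcal H[S]$ with $L_sx_t=x_{st}$ for $t\in S$, and let $\mathcal L[S]$ be the WOT-closed algebra generated by $\{L_s:s\in S\}$. Let $\mathcal N=(\mathcal J\xi_\varnothing)^\perp$ and let $$\mathcal L_{\mathcal J}=\{P_{\mathcal N}A|_{\mathcal N}:A\in\mathcal L_d\}.$$ Then $\mathcal L_{\mathcal J}$ and $\mathcal L[S]$ are unitarily equivalent: there is a unitary $U:\mathcal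 N\to\mathcal H[S]$ with $U\mathcal L_{\mathcal J}U^*=\mathcal L[S]$. -/

import Mathlib

open scoped ENNReal

noncomputable section

namespace FockAlg

/-! ### Hilbert spaces `ℓ²(ι)`, isometries between them, topologies on operators -/

/-- The complex Hilbert space `ℓ²(ι)`. -/
abbrev L2 (ι : Type) : Type := lp (fun _ : ι => ℂ) 2

/-- The bounded operators on a normed space. -/
abbrev Op (H : Type) [NormedAddCommGroup H] [NormedSpace ℂ H] : Type := H →L[ℂ] H

open Classical in
/-- The standard orthonormal basis `(ξ_i)` of `ℓ²(ι)`. -/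
def basisVec {ι : Type} (i : ι) : L2 ι := lp.single 2 i (1 : ℂ)

theorem basisVec_apply_self {ι : Type} (i : ι) : (basisVec i : L2 ι) i = 1 := by
  classical simp [basisVec]

theorem basisVec_apply_ne {ι : Type} {i j : ι} (h : j ≠ i) : (basisVec i : L2 ι) j = 0 := by
  classical simp [basisVec, lp.single_apply, h]

theorem inner_basisVec_left {ι : Type} (i : ι) (f : L2 ι) : inner ℂ (basisVec i) f = f i := by
  classical simp [basisVec, lp.inner_single_left]

theorem orthonormal_basisVec (ι : Type) : Orthonormal ℂ (basisVec : ι → L2 ι) := by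
  classical
  rw [orthonormal_iff_ite]
  intro i j
  rw [inner_basisVec_left]
  by_cases h : i = j
  · subst h; simp [basisVec_apply_self]
  · simp [basisVec_apply_ne h, h]

theorem op_ext_basisVec {ι : Type} {E : Type} [NormedAddCommGroup E] [NormedSpace ℂ E]
    {S T : L2 ι →L[ℂ] E} (h : ∀ i, S (basisVec i) = T (basisVec i)) : S = T := by
  classical
  refine lp.ext_continuousLinearMap (by simp) fun i => ?_
  ext
  simpa [basisVec] using h i

/-- For an injective map `g : ι → κ`, the isometry `ℓ²(ι) → ℓ²(κ)` with `ξ_i ↦ ξ_{g i}`. -/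
def reindex {ι κ : Type} (g : ι → κ) (hg : Function.Injective g) : L2 ι →ₗᵢ[ℂ] L2 κ :=
  ((orthonormal_basisVec κ).comp g hg).orthogonalFamily.linearIsometry

theorem reindex_basisVec {ι κ : Type} (g : ι → κ) (hg : Function.Injective g) (i : ι) :
    reindex g hg (basisVec i) = basisVec (g i) := by
  classical
  simp [reindex, basisVec, OrthogonalFamily.linearIsometry_apply_single]

/-- The closure of a set of operators in the weak operator topology. -/
def wotClosure {H : Type} [NormedAddCommGroup H] [NormedSpace ℂ H] (s : Set (Op H)) :
    Set (Op H) :=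
  {A | ContinuousLinearMapWOT.ofCLM A ∈
    closure ((ContinuousLinearMapWOT.ofCLM : Op H → (H →WOT[ℂ] H)) '' s)}

theorem subset_wotClosure {H : Type} [NormedAddCommGroup H] [NormedSpace ℂ H] (s : Set (Op H)) :
    s ⊆ wotClosure s :=
  fun _ hA => subset_closure (Set.mem_image_of_mem _ hA)

/-- The weak* (ultraweak) topology on `B(H)`, as the dual of the trace class: the coarsest
topology making `A ↦ ∑ₙ ⟪yₙ, A xₙ⟫` continuous for all square-summable sequences `(xₙ)`, `(yₙ)`
in `H`. -/
@[reducible] def weakStarTopology (H : Type) [NormedAddCommGroup H] [InnerProductSpace ℂ H] :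
    TopologicalSpace (Op H) :=
  TopologicalSpace.induced
    (fun (A : Op H) (p : lp (fun _ : ℕ => H) 2 × lp (fun _ : ℕ => H) 2) =>
      ∑' n, inner ℂ (p.2 n) (A (p.1 n)))
    inferInstance

/-- The closure of a set of operators in the weak* topology of `B(H)`. -/
def weakStarClosure {H : Type} [NormedAddCommGroup H] [InnerProductSpace ℂ H] (s : Set (Op H)) :
    Set (Op H) :=
  @closure (Op H) (weakStarTopology H) s

/-! ### Ampliations, tensor products of operators -/

theorem injective_slice {κ ι τ : Type} {g : κ → ι → τ}
    (hg : Function.Injective (Function.uncurry g)) (k : κ) : Function.Injective (g k) :=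
  fun i j h => (Prod.ext_iff.1 (@hg (k, i) (k, j) h)).2

theorem orthogonalFamily_reindex {κ ι τ : Type} (g : κ → ι → τ)
    (hg : Function.Injective (Function.uncurry g)) :
    OrthogonalFamily ℂ (fun _ : κ => L2 ι) (fun k => reindex (g k) (injective_slice hg k)) := by
  intro k l hkl x y
  have key : ∀ i (y : L2 ι), inner ℂ (basisVec (g k i) : L2 τ)
      (reindex (g l) (injective_slice hg l) y) = 0 := by
    intro i y
    have h0 : (innerSL ℂ (basisVec (g k i) : L2 τ)) ∘L
        (reindex (g l) (injective_slice hg l)).toContinuousLinearMap = 0 := by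
      apply op_ext_basisVec
      intro j
      have hne : g k i ≠ g l j := fun h => hkl (Prod.ext_iff.1 (@hg (k, i) (l, j) h)).1
      have : inner ℂ (basisVec (g k i) : L2 τ)
          (reindex (g l) (injective_slice hg l) (basisVec j)) = 0 := by
        rw [reindex_basisVec, inner_basisVec_left, basisVec_apply_ne hne]
      exact this
    exact DFunLike.congr_fun h0 y
  have h1 : (innerSL ℂ (reindex (g l) (injective_slice hg l) y)) ∘L
      (reindex (g k) (injective_slice hg k)).toContinuousLinearMap = 0 := by
    apply op_ext_basisVec
    intro j
    have : inner ℂ (reindex (g l) (injective_slice hg l) y)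
        (reindex (g k) (injective_slice hg k) (basisVec j)) = 0 := by
      rw [reindex_basisVec]
      exact inner_eq_zero_symm.1 (key j y)
    exact this
  exact inner_eq_zero_symm.1 (DFunLike.congr_fun h1 x)

/-- Let `g : κ → ι → τ` be jointly injective, and let `W : ⨁_κ ℓ²(ι) → ℓ²(τ)` be the isometry
which sends the vector `ξ_i` of the `k`-th summand to `ξ_{g k i}`. The ampliation of `A ∈ B(ℓ²(ι))`
along `g` is `W (⨁_κ A) W*`. -/
def ampliation {κ ι τ : Type} (g : κ → ι → τ) (hg : Function.Injective (Function.uncurry g))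
    (A : Op (L2 ι)) : Op (L2 τ) :=
  (orthogonalFamily_reindex g hg).linearIsometry.toContinuousLinearMap ∘L
    lp.mapCLM 2 (fun _ : κ => A) (norm_nonneg A) (fun _ => le_rfl) ∘L
    ContinuousLinearMap.adjoint
      (orthogonalFamily_reindex g hg).linearIsometry.toContinuousLinearMap

theorem ampliation_basisVec {κ ι τ : Type} (g : κ → ι → τ)
    (hg : Function.Injective (Function.uncurry g)) (A : Op (L2 ι)) (k : κ) (i : ι) :
    ampliation g hg A (basisVec (g k i)) =
      reindex (g k) (injective_slice hg k) (A (basisVec i)) := by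
  classical
  have h1 : basisVec (g k i) = (orthogonalFamily_reindex g hg).linearIsometry
      (lp.single 2 k (basisVec i)) := by
    rw [OrthogonalFamily.linearIsometry_apply_single]
    exact (reindex_basisVec _ _ _).symm
  have h2 : ContinuousLinearMap.adjoint
      (orthogonalFamily_reindex g hg).linearIsometry.toContinuousLinearMap (basisVec (g k i))
      = lp.single 2 k (basisVec i) := by
    rw [h1]
    refine ext_inner_left ℂ fun z => ?_
    rw [ContinuousLinearMap.adjoint_inner_right]
    exact LinearIsometry.inner_map_map _ _ _
  have h3 : lp.mapCLM 2 (fun _ : κ => A) (norm_nonneg A) (fun _ => le_rfl)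
      (lp.single 2 k (basisVec i)) = lp.single 2 k (A (basisVec i)) := by
    ext j : 2
    by_cases h : j = k
    · subst h; simp
    · simp [lp.single_apply, h]
  simp only [ampliation, ContinuousLinearMap.comp_apply, h2, h3]
  exact OrthogonalFamily.linearIsometry_apply_single (orthogonalFamily_reindex g hg) _

/-- The operator `A ⊗ B = (A ⊗ 1)(1 ⊗ B)` on `ℓ²(ι) ⊗ ℓ²(κ) = ℓ²(ι × κ)`, where
`ξ_i ⊗ ξ_k = ξ_{(i,k)}`. -/
def tensorOp {ι κ : Type} (A : Op (L2 ι)) (B : Op (L2 κ)) : Op (L2 (ι × κ)) :=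
  ampliation (fun (k : κ) (i : ι) => (i, k)) (fun _ _ h => Prod.swap_injective h) A ∘L
    ampliation (fun (i : ι) (k : κ) => (i, k)) Function.injective_id B

theorem reindex_apply {ι κ : Type} (g : ι → κ) (hg : Function.Injective g) (f : L2 ι) (i : ι) :
    reindex g hg f (g i) = f i := by
  rw [← inner_basisVec_left, ← reindex_basisVec g hg, LinearIsometry.inner_map_map,
    inner_basisVec_left]

theorem reindex_apply_eq_zero {ι κ : Type} (g : ι → κ) (hg : Function.Injective g) (f : L2 ι)
    (k : κ) (hk : ∀ i, g i ≠ k) : reindex g hg f k = 0 := by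
  have h : (innerSL ℂ (basisVec k : L2 κ)) ∘L (reindex g hg).toContinuousLinearMap = 0 := by
    apply op_ext_basisVec
    intro i
    have : inner ℂ (basisVec k : L2 κ) (reindex g hg (basisVec i)) = 0 := by
      rw [reindex_basisVec, inner_basisVec_left, basisVec_apply_ne (hk i).symm]
    exact this
  have h' : inner ℂ (basisVec k : L2 κ) (reindex g hg f) = 0 := DFunLike.congr_fun h f
  rwa [inner_basisVec_left] at h'

/-- `(A ⊗ B)(ξ_i ⊗ ξ_k) = A ξ_i ⊗ B ξ_k`, coordinatewise. -/
theorem tensorOp_basisVec_apply {ι κ : Type} (A : Op (L2 ι)) (B : Op (L2 κ)) (i p : ι) (k q : κ) :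
    tensorOp A B (basisVec (i, k)) (p, q) = A (basisVec i) p * B (basisVec k) q := by
  have hA : Function.Injective (Function.uncurry fun (k : κ) (i : ι) => (i, k)) :=
    fun _ _ h => Prod.swap_injective h
  have hB : Function.Injective (Function.uncurry fun (i : ι) (k : κ) => (i, k)) :=
    Function.injective_id
  have key : (innerSL ℂ (basisVec (p, q) : L2 (ι × κ))) ∘L ampliation _ hA A ∘L
      (reindex (fun k : κ => (i, k)) (injective_slice hB i)).toContinuousLinearMap =
      (A (basisVec i) p) • innerSL ℂ (basisVec q : L2 κ) := by
    apply op_ext_basisVec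
    intro l
    have h1 : ampliation _ hA A (basisVec (i, l)) =
        reindex (fun i : ι => (i, l)) (injective_slice hA l) (A (basisVec i)) :=
      ampliation_basisVec _ hA A l i
    have h2 : inner ℂ (basisVec (p, q) : L2 (ι × κ)) (ampliation _ hA A
        (reindex (fun k : κ => (i, k)) (injective_slice hB i) (basisVec l))) =
        A (basisVec i) p * inner ℂ (basisVec q : L2 κ) (basisVec l) := by
      rw [reindex_basisVec, h1, inner_basisVec_left, inner_basisVec_left]
      by_cases hq : q = l
      · subst hq
        rw [basisVec_apply_self, mul_one]
        exact reindex_apply (fun i : ι => (i, q)) _ _ p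
      · rw [basisVec_apply_ne hq, mul_zero]
        refine reindex_apply_eq_zero _ _ _ _ fun j hj => hq (Prod.ext_iff.1 hj).2.symm
    exact h2
  have h3 : ampliation _ hB B (basisVec (i, k)) =
      reindex (fun k : κ => (i, k)) (injective_slice hB i) (B (basisVec k)) :=
    ampliation_basisVec _ hB B i k
  have h4 := DFunLike.congr_fun key (B (basisVec k))
  have h5 : inner ℂ (basisVec (p, q) : L2 (ι × κ)) (ampliation _ hA A
      (reindex (fun k : κ => (i, k)) (injective_slice hB i) (B (basisVec k)))) =
      A (basisVec i) p * inner ℂ (basisVec q : L2 κ) (B (basisVec k)) := h4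
  rw [← h3, inner_basisVec_left, inner_basisVec_left] at h5
  exact h5

/-! ### The free semigroup and its left regular representation -/

/-- The free semigroup on `d` generators with unit `∅`. -/
abbrev Word (d : ℕ) : Type := FreeMonoid (Fin d)

/-- The full Fock space `ℓ²(𝔽_d⁺)`. -/
abbrev Fock (d : ℕ) : Type := L2 (Word d)

/-- The left regular representation of the free semigroup with zero adjoined:
`L_u ξ_w = ξ_{uw}`, and `L_0 = 0`. -/
def leftReg {d : ℕ} : WithZero (Word d) → Op (Fock d)
  | 0 => 0
  | (u : Word d) => (reindex (fun w => u * w) (mul_right_injective u)).toContinuousLinearMap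

theorem leftReg_basisVec {d : ℕ} (u w : Word d) :
    leftReg (u : WithZero (Word d)) (basisVec w) = basisVec (u * w) :=
  reindex_basisVec _ (mul_right_injective u) _


theorem leftReg_mul {d : ℕ} (u v : WithZero (Word d)) :
    leftReg (u * v) = leftReg u * leftReg v := by
  induction u using WithZero.recZeroCoe with
  | zero => rw [zero_mul]; exact (zero_mul _).symm
  | coe u =>
    induction v using WithZero.recZeroCoe with
    | zero => rw [mul_zero]; exact (mul_zero _).symm
    | coe v =>
      rw [← WithZero.coe_mul]
      apply op_ext_basisVec
      intro w
      have h : (leftReg (u : WithZero (Word d)) * leftReg (v : WithZero (Word d))) (basisVec w) =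
          leftReg (u : WithZero (Word d)) (leftReg (v : WithZero (Word d)) (basisVec w)) := rfl
      rw [h, leftReg_basisVec, leftReg_basisVec, leftReg_basisVec, mul_assoc]

/-- The free semigroup algebra `𝓛_d`: the unital WOT-closed algebra generated by the left
regular representation of the free semigroup. -/
def freeAlg (d : ℕ) : Set (Op (Fock d)) :=
  wotClosure (Algebra.adjoin ℂ (Set.range fun u : Word d => leftReg (u : WithZero (Word d))))

theorem leftReg_mem_freeAlg {d : ℕ} (u : WithZero (Word d)) : leftReg u ∈ freeAlg d := by
  apply subset_wotClosure
  induction u using WithZero.recZeroCoe with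
  | zero => exact zero_mem (Algebra.adjoin ℂ _)
  | coe u => exact Algebra.subset_adjoin ⟨u, rfl⟩

/-! ### The comultiplication and Hopf ideals -/

/-- Pairs of words without a common nonempty prefix. Every pair of words is `(wa, wb)` for a
unique word `w` (the longest common prefix) and a unique such pair `(a, b)`. -/
def CoprimePair (d : ℕ) : Type :=
  {p : Word d × Word d // ∀ w a b : Word d, p = (w * a, w * b) → w = 1}

theorem coprimePair_injective (d : ℕ) : Function.Injective (Function.uncurry
    fun (c : CoprimePair d) (w : Word d) => (w * c.1.1, w * c.1.2)) := by
  have aux : ∀ (c c' : CoprimePair d) (w w' : Word d), w * c.1.1 = w' * c'.1.1 →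
      w * c.1.2 = w' * c'.1.2 → w.length ≤ w'.length → w = w' := by
    intro c c' w w' h1 h2 hl
    have hp : w.toList <+: w'.toList := by
      refine List.prefix_of_prefix_length_le (l₃ := (w * c.1.1).toList) ?_ ?_ hl
      · exact ⟨c.1.1.toList, rfl⟩
      · rw [h1]; exact ⟨c'.1.1.toList, rfl⟩
    obtain ⟨v, hv⟩ := hp
    have hv' : w * FreeMonoid.ofList v = w' := hv
    subst hv'
    rw [mul_assoc] at h1 h2
    have := c.2 (FreeMonoid.ofList v) c'.1.1 c'.1.2
      (Prod.ext (mul_left_cancel h1) (mul_left_cancel h2))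
    rw [this, mul_one]
  rintro ⟨c, w⟩ ⟨c', w'⟩ h
  obtain ⟨h1, h2⟩ := Prod.ext_iff.1 h
  simp only [Function.uncurry] at h1 h2
  have hw : w = w' := by
    rcases le_total w.length w'.length with hl | hl
    · exact aux c c' w w' h1 h2 hl
    · exact (aux c' c w' w h1.symm h2.symm hl).symm
  subst hw
  exact Prod.ext (Subtype.ext (Prod.ext (mul_left_cancel h1) (mul_left_cancel h2))) rfl

theorem exists_coprimePair {d : ℕ} (u v : Word d) :
    ∃ (c : CoprimePair d) (w : Word d), (w * c.1.1, w * c.1.2) = (u, v) := by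
  induction hn : u.length using Nat.strong_induction_on generalizing u v with
  | _ n ih =>
    by_cases h : ∀ w a b : Word d, (u, v) = (w * a, w * b) → w = 1
    · exact ⟨⟨(u, v), h⟩, 1, by simp⟩
    · push Not at h
      obtain ⟨w, a, b, hab, hw⟩ := h
      obtain ⟨h1, h2⟩ := Prod.ext_iff.1 hab
      simp only at h1 h2
      subst h1 h2
      have hpos : w.length ≠ 0 := fun h0 => hw (FreeMonoid.length_eq_zero.1 h0)
      rw [FreeMonoid.length_mul] at hn
      obtain ⟨c, w', hc⟩ := ih a.length (by omega) a b rfl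
      obtain ⟨h1, h2⟩ := Prod.ext_iff.1 hc
      simp only at h1 h2
      exact ⟨c, w * w', by rw [mul_assoc, mul_assoc, h1, h2]⟩

/-- The comultiplication `Δ` of `𝓛_d`, with values in the operators on
`ℓ²(𝔽_d⁺) ⊗ ℓ²(𝔽_d⁺) = ℓ²(𝔽_d⁺ × 𝔽_d⁺)`. It is the weak*-continuous unital homomorphism with
`Δ(L_w) = L_w ⊗ L_w` (`comul_leftReg`): the unitary
`ξ_w ⊗ ξ_{(a,b)} ↦ ξ_{wa} ⊗ ξ_{wb}`, where `(a, b)` ranges over the pairs of words without common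
prefix, intertwines `L_u ⊗ 1` and `L_u ⊗ L_u`, and `Δ(A)` is the operator which corresponds to
`A ⊗ 1`. -/
def comul {d : ℕ} (A : Op (Fock d)) : Op (L2 (Word d × Word d)) :=
  ampliation (fun (c : CoprimePair d) (w : Word d) => (w * c.1.1, w * c.1.2))
    (coprimePair_injective d) A

theorem comul_leftReg {d : ℕ} (u : Word d) :
    comul (leftReg (u : WithZero (Word d))) =
      tensorOp (leftReg (u : WithZero (Word d))) (leftReg (u : WithZero (Word d))) := by
  apply op_ext_basisVec
  rintro ⟨v, v'⟩
  obtain ⟨c, w, hc⟩ := exists_coprimePair v v'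
  have h1 : comul (leftReg (u : WithZero (Word d))) (basisVec (v, v')) =
      basisVec (u * v, u * v') := by
    rw [← hc]
    have h := ampliation_basisVec (fun (c : CoprimePair d) (w : Word d) => (w * c.1.1, w * c.1.2))
      (coprimePair_injective d) (leftReg (u : WithZero (Word d))) c w
    rw [leftReg_basisVec, reindex_basisVec] at h
    obtain ⟨h1, h2⟩ := Prod.ext_iff.1 hc
    simp only at h1 h2
    rw [← h1, ← h2, ← mul_assoc, ← mul_assoc]
    exact h
  rw [h1]
  ext ⟨p, q⟩
  rw [tensorOp_basisVec_apply, leftReg_basisVec, leftReg_basisVec]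
  by_cases hp : p = u * v
  · by_cases hq : q = u * v'
    · rw [hp, hq]; simp only [basisVec_apply_self, mul_one]
    · rw [basisVec_apply_ne hq, mul_zero, basisVec_apply_ne]
      exact fun h => hq (Prod.ext_iff.1 h).2
  · rw [basisVec_apply_ne hp, zero_mul, basisVec_apply_ne]
    exact fun h => hp (Prod.ext_iff.1 h).1

/-- An ideal of `𝓛_d`: a WOT-closed two-sided ideal. -/
structure IsIdeal {d : ℕ} (J : Submodule ℂ (Op (Fock d))) : Prop where
  subset : (J : Set (Op (Fock d))) ⊆ freeAlg d
  isClosed : wotClosure (J : Set (Op (Fock d))) = J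
  mul_left : ∀ A ∈ freeAlg d, ∀ B ∈ J, A * B ∈ J
  mul_right : ∀ A ∈ freeAlg d, ∀ B ∈ J, B * A ∈ J

/-- A coideal `J` of `𝓛_d`: `Δ(J)` is contained in the weak*-closure of
`J ⊗ 𝓛_d + 𝓛_d ⊗ J`. -/
def IsCoideal {d : ℕ} (J : Submodule ℂ (Op (Fock d))) : Prop :=
  ∀ A ∈ J, comul A ∈ weakStarClosure
    (Submodule.span ℂ
      ({T | ∃ B ∈ J, ∃ C ∈ freeAlg d, T = tensorOp B C} ∪
        {T | ∃ B ∈ freeAlg d, ∃ C ∈ J, T = tensorOp B C}) :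
      Set (Op (L2 (Word d × Word d))))

/-- The homogeneous elements of degree `n` in `𝓛_d`: the polynomials `∑_{|w| = n} a_w L_w`. -/
def homogeneousPart (d n : ℕ) : Submodule ℂ (Op (Fock d)) :=
  Submodule.span ℂ {T | ∃ w : Word d, w.length = n ∧ T = leftReg (w : WithZero (Word d))}

/-- `J` is homogeneous: it is the WOT-closed linear span of its homogeneous elements. -/
def IsHomogeneous {d : ℕ} (J : Submodule ℂ (Op (Fock d))) : Prop :=
  (J : Set (Op (Fock d))) =
    wotClosure (⨆ n : ℕ, J ⊓ homogeneousPart d n : Submodule ℂ (Op (Fock d)))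

/-- A homogeneous Hopf ideal of `𝓛_d`. -/
structure IsHomogeneousHopfIdeal {d : ℕ} (J : Submodule ℂ (Op (Fock d))) : Prop where
  isIdeal : IsIdeal J
  isCoideal : IsCoideal J
  isHomogeneous : IsHomogeneous J

/-! ### The compression algebra -/

/-- The coinvariant subspace `N_J = (J ξ_∅)ᗮ`. -/
def coinvariant {d : ℕ} (J : Submodule ℂ (Op (Fock d))) : Submodule ℂ (Fock d) :=
  (Submodule.map (ContinuousLinearMap.apply ℂ (Fock d) (basisVec (1 : Word d))).toLinearMap J)ᗮ

instance {d : ℕ} (J : Submodule ℂ (Op (Fock d))) : CompleteSpace (coinvariant J) :=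
  Submodule.instOrthogonalCompleteSpace _

/-- The compression `P_N A|_N` of an operator to a closed subspace. -/
def compress {H : Type} [NormedAddCommGroup H] [InnerProductSpace ℂ H] (N : Submodule ℂ H)
    [CompleteSpace N] (A : Op H) : Op N :=
  N.orthogonalProjectionOnto ∘L A ∘L N.subtypeL

/-- The compression algebra `𝓛_J = P_N 𝓛_d|_N`, where `N = N_J`. -/
def compressionAlg {d : ℕ} (J : Submodule ℂ (Op (Fock d))) : Set (Op (coinvariant J)) :=
  compress (coinvariant J) '' freeAlg d

/-! ### The semigroup of an ideal and its weighted left regular representation -/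

/-- The semigroup congruence of an ideal `J` on the free semigroup with zero:
`u ∼ v` if and only if `L_u - L_v ∈ J`. -/
def idealCon {d : ℕ} (J : Submodule ℂ (Op (Fock d))) (hJ : IsIdeal J) :
    Con (WithZero (Word d)) where
  r u v := leftReg u - leftReg v ∈ J
  iseqv :=
    { refl := fun u => by simp
      symm := fun {u v} h => by simpa using J.neg_mem h
      trans := fun {u v w} h h' => by simpa using J.add_mem h h' }
  mul' := fun {u v u' v'} h h' => by
    have h1 := hJ.mul_left _ (leftReg_mem_freeAlg u) _ h'
    have h2 := hJ.mul_right _ (leftReg_mem_freeAlg v') _ h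
    have h3 := J.add_mem h1 h2
    simp only [leftReg_mul]
    convert h3 using 1
    noncomm_ring

variable {d : ℕ} (c : Con (WithZero (Word d)))

/-- The equivalence class `[s]` of words (possibly including `0`) that represent `s`. -/
def classOf (s : c.Quotient) : Set (WithZero (Word d)) := {w | (w : c.Quotient) = s}

/-- The set `S₀` of nonzero elements of the quotient semigroup `S`. -/
abbrev NonzeroElt : Type := {s : c.Quotient // s ≠ ((0 : WithZero (Word d)) : c.Quotient)}

/-- The Hilbert space `H[S]`, with orthonormal basis `y_s = basisVec s`, `s ∈ S₀`. -/
abbrev SemigroupSpace : Type := L2 (NonzeroElt c)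

open Classical in
/-- The orthogonal basis vectors `x_s = |[s]|^{-1/2} y_s` of `H[S]`, so that
`(x_s, x_t) = δ_{s,t} / |[s]|`; moreover `x_0 = 0`. -/
def xVec (s : c.Quotient) : SemigroupSpace c :=
  if h : s ≠ ((0 : WithZero (Word d)) : c.Quotient) then
    (((Real.sqrt ((classOf c s).ncard))⁻¹ : ℝ) : ℂ) • basisVec (⟨s, h⟩ : NonzeroElt c)
  else 0

/-- There is an operator `R : ℓ²(𝔽_d⁺) → H[S]` with `R ξ_u = x_u`, whose adjoint sends `x_s` to the
mean of the `ξ_u`, `u ∈ [s]`; it is used only to see that the operators `x_t ↦ x_{st}` are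
bounded. -/
theorem exists_averaging : ∃ (R : Fock d →L[ℂ] SemigroupSpace c)
    (Q : SemigroupSpace c →L[ℂ] Fock d),
    (∀ u : Word d, R (basisVec u) = xVec c ((u : WithZero (Word d)) : c.Quotient)) ∧
    ∀ s : NonzeroElt c, (classOf c s.1).Finite → ∃ F : Finset (Word d),
      (∀ u : Word d, u ∈ F ↔ ((u : WithZero (Word d)) : c.Quotient) = s.1) ∧
      F.card = (classOf c s.1).ncard ∧ F.Nonempty ∧
      Q (xVec c s.1) = ((F.card : ℂ)⁻¹) • ∑ u ∈ F, basisVec u := by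
  classical
  let S₁ : Type := {s : NonzeroElt c // (classOf c s.1).Finite}
  have hF : ∀ s : S₁, ∃ F : Finset (Word d),
      (∀ u : Word d, u ∈ F ↔ ((u : WithZero (Word d)) : c.Quotient) = s.1.1) ∧
      F.card = (classOf c s.1.1).ncard ∧ F.Nonempty := by
    rintro ⟨⟨s, hs⟩, hfin⟩
    have himg : classOf c s = WithZero.coe '' {u : Word d | ((u : WithZero (Word d)) :
        c.Quotient) = s} := by
      ext w
      induction w using WithZero.recZeroCoe with
      | zero =>
        simp only [classOf, Set.mem_ofPred_eq, Set.mem_image, WithZero.coe_ne_zero, and_false,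
          exists_false, iff_false]
        exact fun h => hs h.symm
      | coe w => simp [classOf]
    have hfin' : {u : Word d | ((u : WithZero (Word d)) : c.Quotient) = s}.Finite := by
      rw [himg] at hfin
      exact hfin.of_finite_image (WithZero.coe_injective.injOn)
    refine ⟨hfin'.toFinset, by simp, ?_, ?_⟩
    · rw [himg, Set.ncard_image_of_injective _ WithZero.coe_injective,
        Set.ncard_eq_toFinset_card _ hfin']
    · obtain ⟨w, rfl⟩ := Con.mk'_surjective (c := c) s
      have hw : w ≠ 0 := by rintro rfl; exact hs rfl
      obtain ⟨u, rfl⟩ := WithZero.ne_zero_iff_exists.1 hw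
      exact ⟨u, hfin'.mem_toFinset.2 rfl⟩
  choose F hFmem hFcard hFne using hF
  -- the unit vectors carried by the finite classes
  let f : S₁ → Fock d := fun s => (((Real.sqrt (F s).card)⁻¹ : ℝ) : ℂ) • ∑ u ∈ F s, basisVec u
  have hfapp : ∀ (s : S₁) (u : Word d), inner ℂ (basisVec u) (f s) =
      if ((u : WithZero (Word d)) : c.Quotient) = s.1.1 then
        (((Real.sqrt (F s).card)⁻¹ : ℝ) : ℂ) else 0 := by
    intro s u
    rw [inner_smul_right, inner_sum]
    simp_rw [orthonormal_iff_ite.1 (orthonormal_basisVec (Word d))]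
    rw [Finset.sum_ite_eq]
    simp only [hFmem s u]
    split_ifs <;> simp
  have hforth : Orthonormal ℂ f := by
    rw [orthonormal_iff_ite]
    intro s t
    have h0 : inner ℂ (f s) (f t) = (((Real.sqrt (F s).card)⁻¹ : ℝ) : ℂ) *
        ∑ u ∈ F s, inner ℂ (basisVec u) (f t) := by
      rw [show f s = (((Real.sqrt (F s).card)⁻¹ : ℝ) : ℂ) • ∑ u ∈ F s, basisVec u from rfl,
        inner_smul_left, sum_inner, Complex.conj_ofReal]
    rw [h0]
    by_cases hst : s = t
    · subst hst
      rw [if_pos rfl, Finset.sum_congr rfl fun u hu => by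
        rw [hfapp, if_pos ((hFmem s u).1 hu)], Finset.sum_const, nsmul_eq_mul]
      have hpos : (0 : ℝ) < (F s).card := by exact_mod_cast (hFne s).card_pos
      have h1 : (Real.sqrt (F s).card)⁻¹ * ((F s).card * (Real.sqrt (F s).card)⁻¹) = 1 := by
        have := Real.mul_self_sqrt hpos.le
        have hs := (Real.sqrt_pos.2 hpos).ne'
        field_simp
        nlinarith
      exact_mod_cast h1
    · rw [if_neg hst, Finset.sum_eq_zero, mul_zero]
      intro u hu
      rw [hfapp, if_neg]
      intro h
      exact hst (Subtype.ext (Subtype.ext (((hFmem s u).1 hu).symm.trans h)))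
  let W : L2 S₁ →ₗᵢ[ℂ] Fock d := hforth.orthogonalFamily.linearIsometry
  have hW : ∀ s, W (basisVec s) = f s := by
    intro s
    simp only [W, basisVec]
    rw [OrthogonalFamily.linearIsometry_apply_single]
    simp
  let I : L2 S₁ →ₗᵢ[ℂ] SemigroupSpace c := reindex Subtype.val Subtype.val_injective
  have hadj : ∀ {E E' : Type} [NormedAddCommGroup E] [InnerProductSpace ℂ E] [CompleteSpace E]
      [NormedAddCommGroup E'] [InnerProductSpace ℂ E'] [CompleteSpace E'] (V : E →ₗᵢ[ℂ] E')
      (x : E), ContinuousLinearMap.adjoint V.toContinuousLinearMap (V x) = x := by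
    intro E E' _ _ _ _ _ _ V x
    refine ext_inner_left ℂ fun z => ?_
    rw [ContinuousLinearMap.adjoint_inner_right]
    exact LinearIsometry.inner_map_map _ _ _
  have hWadj : ∀ (u : Word d) (s : S₁),
      ContinuousLinearMap.adjoint W.toContinuousLinearMap (basisVec u) s =
      if ((u : WithZero (Word d)) : c.Quotient) = s.1.1 then
        (((Real.sqrt (F s).card)⁻¹ : ℝ) : ℂ) else 0 := by
    intro u s
    rw [← inner_basisVec_left, ContinuousLinearMap.adjoint_inner_right, ← inner_conj_symm]
    have : W.toContinuousLinearMap (basisVec s) = f s := hW s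
    rw [this, hfapp]
    split_ifs <;> simp
  refine ⟨I.toContinuousLinearMap ∘L ContinuousLinearMap.adjoint W.toContinuousLinearMap,
    W.toContinuousLinearMap ∘L ContinuousLinearMap.adjoint I.toContinuousLinearMap, ?_, ?_⟩
  · intro u
    by_cases hu : ((u : WithZero (Word d)) : c.Quotient) ≠ ((0 : WithZero (Word d)) : c.Quotient)
    · by_cases hfin : (classOf c ((u : WithZero (Word d)) : c.Quotient)).Finite
      · let s : S₁ := ⟨⟨_, hu⟩, hfin⟩
        have h1 : ContinuousLinearMap.adjoint W.toContinuousLinearMap (basisVec u) =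
            (((Real.sqrt (F s).card)⁻¹ : ℝ) : ℂ) • basisVec s := by
          ext t
          rw [hWadj, lp.coeFn_smul, Pi.smul_apply, smul_eq_mul]
          by_cases ht : t = s
          · subst ht
            rw [if_pos rfl, basisVec_apply_self, mul_one]
          · rw [basisVec_apply_ne ht, mul_zero, if_neg]
            exact fun h => ht (Subtype.ext (Subtype.ext h.symm))
        rw [ContinuousLinearMap.comp_apply, h1, map_smul]
        have h2 : I.toContinuousLinearMap (basisVec s) = basisVec s.1 :=
          reindex_basisVec Subtype.val Subtype.val_injective s
        rw [h2, xVec, dif_pos hu, hFcard s]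
      · have h1 : ContinuousLinearMap.adjoint W.toContinuousLinearMap (basisVec u) = 0 := by
          ext t
          rw [hWadj, if_neg]
          · rfl
          · intro h
            apply hfin
            rw [h]
            exact t.2
        rw [ContinuousLinearMap.comp_apply, h1, map_zero, xVec, dif_pos hu,
          Set.Infinite.ncard hfin]
        simp
    · have h1 : ContinuousLinearMap.adjoint W.toContinuousLinearMap (basisVec u) = 0 := by
        ext t
        rw [hWadj, if_neg]
        · rfl
        · intro h
          exact hu (h ▸ t.1.2)
      rw [ContinuousLinearMap.comp_apply, h1, map_zero, xVec, dif_neg hu]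
  · intro s hs
    let s' : S₁ := ⟨s, hs⟩
    refine ⟨F s', hFmem s', hFcard s', hFne s', ?_⟩
    have h2 : I (basisVec s') = basisVec s :=
      reindex_basisVec Subtype.val Subtype.val_injective s'
    have h3 : xVec c s.1 = (((Real.sqrt (F s').card)⁻¹ : ℝ) : ℂ) • I (basisVec s') := by
      rw [xVec, dif_pos s.2, h2, hFcard s']
    rw [h3, map_smul, ContinuousLinearMap.comp_apply, hadj]
    have h4 : W.toContinuousLinearMap (basisVec s') = f s' := hW s'
    rw [h4, smul_smul]
    congr 1
    have h5 : (Real.sqrt (F s').card)⁻¹ * (Real.sqrt (F s').card)⁻¹ = ((F s').card : ℝ)⁻¹ := by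
      rw [← mul_inv, Real.mul_self_sqrt (Nat.cast_nonneg _)]
    rw [← Complex.ofReal_mul, h5]
    simp

theorem xVec_zero : xVec c ((0 : WithZero (Word d)) : c.Quotient) = 0 := by
  simp [xVec]

theorem xVec_eq_zero_of_infinite (s : c.Quotient) (h : (classOf c s).Infinite) :
    xVec c s = 0 := by
  rw [xVec, h.ncard]
  split_ifs <;> simp

theorem exists_weightedLeftReg (s : c.Quotient) :
    ∃ T : Op (SemigroupSpace c), ∀ t : c.Quotient, T (xVec c t) = xVec c (s * t) := by
  classical
  obtain ⟨R, Q, hR, hQ⟩ := exists_averaging c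
  obtain ⟨w, rfl⟩ := Con.mk'_surjective (c := c) s
  change ∃ T : Op (SemigroupSpace c), ∀ t : c.Quotient,
    T (xVec c t) = xVec c ((w : c.Quotient) * t)
  induction w using WithZero.recZeroCoe with
  | zero =>
    refine ⟨0, fun t => ?_⟩
    obtain ⟨v, rfl⟩ := Con.mk'_surjective (c := c) t
    change _ = xVec c (((0 * v : WithZero (Word d))) : c.Quotient)
    rw [zero_mul, xVec_zero]
    rfl
  | coe w =>
    refine ⟨R ∘L leftReg (w : WithZero (Word d)) ∘L Q, fun t => ?_⟩
    by_cases ht : t = ((0 : WithZero (Word d)) : c.Quotient)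
    · subst ht
      have : ((w : WithZero (Word d)) : c.Quotient) * ((0 : WithZero (Word d)) : c.Quotient) =
          ((0 : WithZero (Word d)) : c.Quotient) := by
        rw [← Con.coe_mul, mul_zero]
      rw [this, xVec_zero, map_zero]
    by_cases hfin : (classOf c t).Finite
    · obtain ⟨F, hF, -, hne, hQt⟩ := hQ ⟨t, ht⟩ hfin
      simp only at hQt hF
      rw [ContinuousLinearMap.comp_apply, ContinuousLinearMap.comp_apply, hQt, map_smul, map_smul,
        map_sum, map_sum]
      rw [Finset.sum_congr rfl fun u hu => by
        rw [leftReg_basisVec, hR, WithZero.coe_mul, Con.coe_mul, (hF u).1 hu]]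
      rw [Finset.sum_const, ← Nat.cast_smul_eq_nsmul ℂ, smul_smul, inv_mul_cancel₀, one_smul]
      exact_mod_cast hne.card_pos.ne'
    · rw [xVec_eq_zero_of_infinite c t hfin, map_zero]
      by_cases hz : ((w : WithZero (Word d)) : c.Quotient) * t =
          ((0 : WithZero (Word d)) : c.Quotient)
      · rw [hz, xVec_zero]
      · rw [xVec_eq_zero_of_infinite]
        have hinj : Function.Injective fun v : WithZero (Word d) => (w : WithZero (Word d)) * v :=
          by
          intro v v' h
          induction v using WithZero.recZeroCoe with
          | zero =>
            induction v' using WithZero.recZeroCoe with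
            | zero => rfl
            | coe v' => simp [← WithZero.coe_mul] at h
          | coe v =>
            induction v' using WithZero.recZeroCoe with
            | zero => simp [← WithZero.coe_mul] at h
            | coe v' =>
              simp only [← WithZero.coe_mul, WithZero.coe_inj] at h
              rw [mul_left_cancel h]
        refine (Set.Infinite.image hinj.injOn hfin).mono ?_
        rintro _ ⟨v, hv, rfl⟩
        change (((w : WithZero (Word d)) * v : WithZero (Word d)) : c.Quotient) = _
        rw [Con.coe_mul, show (v : c.Quotient) = t from hv]

/-- The weighted left regular representation of `S` on `H[S]`: the bounded operator `L_s` with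
`L_s x_t = x_{st}` for `t ∈ S`. -/
def weightedLeftReg (s : c.Quotient) : Op (SemigroupSpace c) :=
  Classical.choose (exists_weightedLeftReg c s)

theorem weightedLeftReg_xVec (s t : c.Quotient) :
    weightedLeftReg c s (xVec c t) = xVec c (s * t) :=
  Classical.choose_spec (exists_weightedLeftReg c s) t

/-- The semigroup algebra `𝓛[S]`: the WOT-closed algebra generated by the operators `L_s`. -/
def semigroupAlg : Set (Op (SemigroupSpace c)) :=
  wotClosure (Algebra.adjoin ℂ (Set.range (weightedLeftReg c)))

/-- Algebras of operators `𝓐` on `H` and `𝓑` on `K` are unitarily equivalent: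
`U 𝓐 U* = 𝓑` for some unitary `U : H → K`. -/
def UnitarilyEquivalent {H K : Type} [NormedAddCommGroup H] [InnerProductSpace ℂ H]
    [CompleteSpace H] [NormedAddCommGroup K] [InnerProductSpace ℂ K] [CompleteSpace K]
    (𝓐 : Set (Op H)) (𝓑 : Set (Op K)) : Prop :=
  ∃ U : H ≃ₗᵢ[ℂ] K, U.conjStarAlgEquiv '' 𝓐 = 𝓑

end FockAlg

end

noncomputable section

namespace FockAlg

/-! Write `N = coinvariant J` and regard its vectors as functions on words. The proof has two
independent halves: identifying `N` with `H[S]`, and identifying the algebras.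

For the space: since `J` is homogeneous, `N` contains the homogeneous components of its elements,
and a homogeneous operator whose symbol is orthogonal to `N` lies in `J`
(`mem_of_inner_coinvariant_eq_zero`). Hence `u ∼ v` exactly when all functions in `N` agree at `u`
and `v`, and `u ∼ 0` exactly when they all vanish at `u`. The coideal condition is dual to a
multiplication: finitely supported functions in `N` are closed under pointwise products
(`exists_mul_mem_coinvariant`). An algebra of functions on the finite set of words of a given length
contains the indicators of the nonzero classes that it separates
(`exists_indicator_mem_coinvariant`). So the normalised indicators form an orthonormal basis of `N`,
and sending them to the basis of `H[S]` gives a unitary `U` with `U P_N ξ_u = x_u`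
(`exists_unitary`).

For the algebras: `U` carries the compression of `L_u` to `L_[u]`, and compression is
WOT-continuous, so `U 𝓛_J U* ⊆ 𝓛[S]`. The reverse inclusion would follow from WOT-closedness of
`𝓛_J`, which is supplied by commutant lifting. Everything in `𝓛[S]` commutes with the transported
compressions of the right regular representation; an operator on `N` commuting with those
compressions is the compression of an operator commuting with all `R_v`
(`exists_intertwining_extension`, applied to adjoints); and such operators form `𝓛_d`
(`mem_freeAlg_iff`, by Cesàro means). -/

/-! ### Auxiliary facts on `ℓ²` and the weak operator topology -/

/-- Hahn–Banach for the seminorm of a positive semidefinite sesquilinear form. -/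
theorem exists_extension_le_core {V : Type} [AddCommGroup V] [Module ℂ V]
    (q : PreInnerProductSpace.Core ℂ V) (D : Submodule ℂ V) (φ : D →ₗ[ℂ] ℂ)
    (h : ∀ x : D, ‖φ x‖ ^ 2 ≤ RCLike.re (q.inner x x)) :
    ∃ g : V →ₗ[ℂ] ℂ, (∀ x : D, g x = φ x) ∧ ∀ x, ‖g x‖ ^ 2 ≤ RCLike.re (q.inner x x) := by
  -- The form itself supplies the seminorm, so `h` says that `φ` has norm at most `1` on `D`.
  let : SeminormedAddCommGroup V := InnerProductSpace.Core.toSeminormedAddCommGroup (𝕜 := ℂ)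
  let : InnerProductSpace ℂ V := InnerProductSpace.ofCore q
  have hsq : ∀ x : V, RCLike.re (q.inner x x) = ‖x‖ ^ 2 := fun x =>
    (norm_sq_eq_re_inner (𝕜 := ℂ) x).symm
  have hφ : ∀ x : D, ‖φ x‖ ≤ 1 * ‖x‖ := by
    intro x
    rw [one_mul]
    have := h x
    rw [hsq] at this
    exact le_of_sq_le_sq this (norm_nonneg _)
  obtain ⟨g, hg, hgn⟩ := exists_extension_norm_eq D (φ.mkContinuous 1 hφ)
  refine ⟨g.toLinearMap, hg, fun x => ?_⟩
  rw [hsq]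
  have h1 : ‖g‖ ≤ 1 := hgn ▸ LinearMap.mkContinuous_norm_le _ zero_le_one _
  have h2 : ‖g x‖ ≤ ‖x‖ := (g.le_of_opNorm_le h1 x).trans_eq (one_mul _)
  exact pow_le_pow_left₀ (norm_nonneg _) h2 2

/-- Two vectors of `ℓ²(ι)` with the same coordinates agree. -/
theorem ext_coord {ι : Type} {f g : L2 ι} (h : ∀ i, f i = g i) : f = g := by
  ext i; exact h i

/-- A linear identity between matrix coefficients passes to the closure in the weak operator
topology. -/
theorem wotClosure_induction {H : Type} [NormedAddCommGroup H] [InnerProductSpace ℂ H]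
    [CompleteSpace H] {s : Set (Op H)} {x y x' y' : H}
    (h : ∀ A ∈ s, inner ℂ y (A x) = inner ℂ y' (A x')) {A : Op H} (hA : A ∈ wotClosure s) :
    inner ℂ y (A x) = inner ℂ y' (A x') := by
  have hc : IsClosed {T : H →WOT[ℂ] H | inner ℂ y (T x) = inner ℂ y' (T x')} :=
    isClosed_eq (ContinuousLinearMapWOT.continuous_inner_apply continuous_id x y)
      (ContinuousLinearMapWOT.continuous_inner_apply continuous_id x' y')
  have hs : (ContinuousLinearMapWOT.ofCLM : Op H → (H →WOT[ℂ] H)) '' s ⊆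
      {T : H →WOT[ℂ] H | inner ℂ y (T x) = inner ℂ y' (T x')} := by
    rintro _ ⟨B, hB, rfl⟩
    exact h B hB
  exact closure_minimal hs hc hA

/-- The commutant of an operator is closed in the weak operator topology. -/
theorem commute_of_mem_wotClosure {H : Type} [NormedAddCommGroup H] [InnerProductSpace ℂ H]
    [CompleteSpace H] {s : Set (Op H)} {B : Op H} (h : ∀ A ∈ s, A * B = B * A) {A : Op H}
    (hA : A ∈ wotClosure s) : A * B = B * A := by
  ext x
  refine ext_inner_left ℂ fun y => ?_
  change inner ℂ y (A (B x)) = inner ℂ y (B (A x))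
  rw [← ContinuousLinearMap.adjoint_inner_left B (A x) y]
  refine wotClosure_induction (fun T hT => ?_) hA
  rw [ContinuousLinearMap.adjoint_inner_left]
  exact congrArg (fun S : Op H => inner ℂ y (S x)) (h T hT)

/-! ### The right regular representation -/

/-- The right regular representation `R_v ξ_w = ξ_{wv}`. -/
def rightReg {d : ℕ} (v : Word d) : Op (Fock d) :=
  (reindex (fun w => w * v) (mul_left_injective v)).toContinuousLinearMap

theorem rightReg_basisVec {d : ℕ} (v w : Word d) :
    rightReg v (basisVec w) = basisVec (w * v) :=
  reindex_basisVec _ (mul_left_injective v) _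

theorem rightReg_apply_mul {d : ℕ} (v w : Word d) (x : Fock d) : rightReg v x (w * v) = x w :=
  reindex_apply (fun w => w * v) (mul_left_injective v) x w

theorem adjoint_rightReg_apply {d : ℕ} (v w : Word d) (x : Fock d) :
    ContinuousLinearMap.adjoint (rightReg v) x w = x (w * v) := by
  rw [← inner_basisVec_left, ContinuousLinearMap.adjoint_inner_right, rightReg_basisVec,
    inner_basisVec_left]

theorem leftReg_commute_rightReg {d : ℕ} (u : Word d) (v : Word d) :
    leftReg (u : WithZero (Word d)) * rightReg v = rightReg v * leftReg u := by
  apply op_ext_basisVec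
  intro w
  change leftReg (u : WithZero (Word d)) (rightReg v (basisVec w)) =
    rightReg v (leftReg (u : WithZero (Word d)) (basisVec w))
  rw [rightReg_basisVec, leftReg_basisVec, leftReg_basisVec, rightReg_basisVec, mul_assoc]

/-- The last letter of a nonempty word. -/
theorem exists_eq_mul_of {d : ℕ} (w : Word d) (hw : w ≠ 1) :
    ∃ (v : Word d) (i : Fin d), w = v * FreeMonoid.of i := by
  rcases List.eq_nil_or_concat' w.toList with h | ⟨l, i, h⟩
  · exact absurd h hw
  · exact ⟨FreeMonoid.ofList l, i, h⟩

theorem mul_of_inj {d : ℕ} {v w : Word d} {i j : Fin d}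
    (h : v * FreeMonoid.of i = w * FreeMonoid.of j) : v = w ∧ i = j := by
  have h' : v.toList ++ [i] = w.toList ++ [j] := h
  obtain ⟨h1, h2⟩ := List.append_inj' h' rfl
  exact ⟨h1, by simpa using h2⟩

theorem mul_of_ne_one {d : ℕ} (v : Word d) (i : Fin d) : v * FreeMonoid.of i ≠ 1 := by
  intro h
  have := congrArg FreeMonoid.length h
  simp [FreeMonoid.length_mul] at this

/-- Adjoints of the right creation operators. -/
def rightAnn {d : ℕ} (i : Fin d) : Op (Fock d) :=
  ContinuousLinearMap.adjoint (rightReg (FreeMonoid.of i))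

theorem rightAnn_apply {d : ℕ} (i : Fin d) (w : Word d) (x : Fock d) :
    rightAnn i x w = x (w * FreeMonoid.of i) :=
  adjoint_rightReg_apply _ _ _

theorem rightReg_of_apply_one {d : ℕ} (i : Fin d) (x : Fock d) :
    rightReg (FreeMonoid.of i) x 1 = 0 :=
  reindex_apply_eq_zero _ (mul_left_injective _) _ _ fun w => mul_of_ne_one w i

theorem rightReg_of_apply_ne {d : ℕ} {i j : Fin d} (h : j ≠ i) (x : Fock d) (w : Word d) :
    rightReg (FreeMonoid.of i) x (w * FreeMonoid.of j) = 0 :=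
  reindex_apply_eq_zero _ (mul_left_injective _) _ _ fun _ hv => h (mul_of_inj hv).2.symm

theorem sum_coord {ι κ : Type} (s : Finset κ) (f : κ → L2 ι) (i : ι) :
    (∑ k ∈ s, f k) i = ∑ k ∈ s, f k i := by
  rw [lp.coeFn_sum, Finset.sum_apply]

theorem rightAnn_sum_rightReg {d : ℕ} (z : Fin d → Fock d) (a : ℂ) (i : Fin d) :
    rightAnn i (∑ j, rightReg (FreeMonoid.of j) (z j) + a • basisVec 1) = z i := by
  refine ext_coord fun w => ?_
  rw [rightAnn_apply, lp.coeFn_add, Pi.add_apply, sum_coord, lp.coeFn_smul, Pi.smul_apply,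
    basisVec_apply_ne (mul_of_ne_one w i), smul_zero, add_zero,
    Finset.sum_eq_single i (fun j _ hj => rightReg_of_apply_ne hj.symm _ _) (by simp),
    rightReg_apply_mul]

theorem sum_rightReg_apply_one {d : ℕ} (z : Fin d → Fock d) (a : ℂ) :
    (∑ j, rightReg (FreeMonoid.of j) (z j) + a • basisVec 1 : Fock d) 1 = a := by
  rw [lp.coeFn_add, Pi.add_apply, sum_coord, lp.coeFn_smul, Pi.smul_apply, basisVec_apply_self,
    Finset.sum_eq_zero fun j _ => rightReg_of_apply_one j _]
  simp

/-- Words are split by their last letter: the ranges of the right creation operators and the vacuum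
line decompose the Fock space, `∑ R_i R_i* + P_∅ = 1`. -/
theorem eq_sum_rightReg {d : ℕ} (x : Fock d) :
    x = ∑ i, rightReg (FreeMonoid.of i) (rightAnn i x) + x 1 • basisVec 1 := by
  refine ext_coord fun w => ?_
  by_cases hw : w = 1
  · subst hw
    rw [sum_rightReg_apply_one]
  · obtain ⟨v, i, rfl⟩ := exists_eq_mul_of w hw
    rw [← rightAnn_apply, ← rightAnn_apply, rightAnn_sum_rightReg]

theorem norm_sq_eq_sum_rightAnn {d : ℕ} (x : Fock d) :
    ‖x‖ ^ 2 = ∑ i, ‖rightAnn i x‖ ^ 2 + ‖x 1‖ ^ 2 := by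
  have h : inner ℂ x x = ∑ i, inner ℂ (rightAnn i x) (rightAnn i x) + (‖x 1‖ ^ 2 : ℂ) := by
    conv_lhs => rw [eq_sum_rightReg x]
    conv_lhs => arg 3; rw [← eq_sum_rightReg x]
    rw [inner_add_left, sum_inner, inner_smul_left, inner_basisVec_left, Complex.conj_mul']
    congr 1
    refine Finset.sum_congr rfl fun i _ => ?_
    exact (ContinuousLinearMap.adjoint_inner_right _ _ _).symm
  simp only [inner_self_eq_norm_sq_to_K, Complex.coe_algebraMap] at h
  exact_mod_cast h

/-! ### Lifting of operators which intertwine the right annihilation operators -/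

/-- A partially defined bounded operator on the Fock space which commutes with the adjoints of the
right creation operators. -/
structure IsPartialIntertwiner {d : ℕ} (C : ℝ) (f : Fock d →ₗ.[ℂ] Fock d) : Prop where
  invariant : ∀ i, ∀ x ∈ f.domain, rightAnn i x ∈ f.domain
  comm : ∀ i (x : f.domain), f ⟨rightAnn i x, invariant i x x.2⟩ = rightAnn i (f x)
  bound : ∀ x : f.domain, ‖f x‖ ≤ C * ‖x‖

/-- The form `C² (x, y) - ∑ᵢ (f aᵢ x, f aᵢ y)` on `{x | aᵢ x ∈ dom f for all i}`, where the `aᵢ` are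
the right annihilation operators. -/
@[reducible] def defectForm {d : ℕ} {C : ℝ} {f : Fock d →ₗ.[ℂ] Fock d}
    (hf : IsPartialIntertwiner C f) :
    PreInnerProductSpace.Core ℂ
      (⨅ i, f.domain.comap (rightAnn i).toLinearMap : Submodule ℂ (Fock d)) where
  inner x y := (C ^ 2 : ℂ) * inner ℂ (x : Fock d) y -
    ∑ i, inner ℂ (f ⟨rightAnn i x, (Submodule.mem_iInf _).1 x.2 i⟩)
      (f ⟨rightAnn i y, (Submodule.mem_iInf _).1 y.2 i⟩)
  conj_inner_symm x y := by simp [inner_conj_symm]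
  -- The bound on `f` gives `∑ ‖f aᵢ x‖² ≤ C² ∑ ‖aᵢ x‖² = C² (‖x‖² - |x(∅)|²)`.
  re_inner_nonneg x := by
    have h1 := norm_sq_eq_sum_rightAnn (x : Fock d)
    have h2 : ∀ i, ‖f ⟨rightAnn i x, (Submodule.mem_iInf _).1 x.2 i⟩‖ ^ 2 ≤
        C ^ 2 * ‖rightAnn i (x : Fock d)‖ ^ 2 := by
      intro i
      rw [← mul_pow]
      exact pow_le_pow_left₀ (norm_nonneg _) (hf.bound ⟨rightAnn i x, _⟩) 2
    have h3 := Finset.sum_le_sum fun i (_ : i ∈ Finset.univ) => h2 i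
    rw [← Finset.mul_sum] at h3
    simp only [inner_self_eq_norm_sq_to_K, Complex.coe_algebraMap]
    have h4 : (0 : ℝ) ≤ C ^ 2 * ‖(x : Fock d)‖ ^ 2 -
        ∑ i, ‖f ⟨rightAnn i x, (Submodule.mem_iInf _).1 x.2 i⟩‖ ^ 2 := by
      rw [h1]
      nlinarith [mul_nonneg (sq_nonneg C) (sq_nonneg ‖(x : Fock d) 1‖)]
    convert h4 using 1
    norm_cast
  add_left x y z := by
    have : ∀ i, f ⟨rightAnn i (x + y : Fock d), (Submodule.mem_iInf _).1 (x + y).2 i⟩ =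
        f ⟨rightAnn i x, (Submodule.mem_iInf _).1 x.2 i⟩ +
        f ⟨rightAnn i y, (Submodule.mem_iInf _).1 y.2 i⟩ := by
      intro i
      rw [← LinearPMap.map_add]
      congr 1
      exact Subtype.ext (map_add _ _ _)
    simp only [Submodule.coe_add, this, inner_add_left, Finset.sum_add_distrib]
    ring
  smul_left x y r := by
    have : ∀ i, f ⟨rightAnn i (r • x : Fock d), (Submodule.mem_iInf _).1 (r • x).2 i⟩ =
        r • f ⟨rightAnn i x, (Submodule.mem_iInf _).1 x.2 i⟩ := by
      intro i
      rw [← LinearPMap.map_smul]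
      congr 1
      exact Subtype.ext (map_smul _ _ _)
    simp only [Submodule.coe_smul, this, inner_smul_left, ← Finset.mul_sum]
    ring

/-- The intertwining relation forces `f' x = ∑ Rᵢ f(aᵢ x) + g(x) ξ_∅`, with only the functional `g`
left to choose. Since `‖f' x‖² = ∑ ‖f(aᵢ x)‖² + |g x|²`, the bound `C` for `f'` says precisely that
`|g|²` is dominated by the defect form. On `dom f` the value `g x = (f x)(∅)` is prescribed and
obeys this bound because `f` obeys its own; Hahn–Banach extends it. -/
theorem IsPartialIntertwiner.exists_extension {d : ℕ} {C : ℝ} (hC : 0 ≤ C)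
    {f : Fock d →ₗ.[ℂ] Fock d} (hf : IsPartialIntertwiner C f) :
    ∃ f', f ≤ f' ∧ IsPartialIntertwiner C f' ∧
      ∀ x, (∀ i, rightAnn i x ∈ f.domain) → x ∈ f'.domain := by
  set E : Submodule ℂ (Fock d) := ⨅ i, f.domain.comap (rightAnn i).toLinearMap with hE
  have hmem : ∀ x, x ∈ E ↔ ∀ i, rightAnn i x ∈ f.domain := fun x => Submodule.mem_iInf _
  have hle : f.domain ≤ E := fun x hx => (hmem x).2 fun i => hf.invariant i x hx
  let D : Submodule ℂ E := f.domain.comap E.subtype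
  let φ : D →ₗ[ℂ] ℂ :=
    (innerSL ℂ (basisVec 1 : Fock d)).toLinearMap ∘ₗ f.toFun ∘ₗ
      (E.subtype.restrict (p := D) (q := f.domain) fun x hx => hx)
  have hφ : ∀ x : D, φ x = f ⟨x, x.2⟩ 1 := fun x => inner_basisVec_left _ _
  have hre : ∀ x : E, RCLike.re ((defectForm hf).inner x x) = C ^ 2 * ‖(x : Fock d)‖ ^ 2 -
      ∑ i, ‖f ⟨rightAnn i x, (hmem x).1 x.2 i⟩‖ ^ 2 := by
    intro x
    change RCLike.re ((C ^ 2 : ℂ) * inner ℂ (x : Fock d) x -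
      ∑ i, inner ℂ (f ⟨rightAnn i x, (hmem x).1 x.2 i⟩)
        (f ⟨rightAnn i x, (hmem x).1 x.2 i⟩)) = _
    simp only [inner_self_eq_norm_sq_to_K, Complex.coe_algebraMap]
    norm_cast
  obtain ⟨g, hg, hgb⟩ := exists_extension_le_core (defectForm hf) D φ (by
    intro x
    rw [hre, hφ]
    have h1 := norm_sq_eq_sum_rightAnn (f ⟨x, x.2⟩)
    have h2 : ∀ i, rightAnn i (f ⟨x, x.2⟩) =
        f ⟨rightAnn i x, (hmem x).1 x.1.2 i⟩ := fun i => (hf.comm i ⟨x, x.2⟩).symm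
    have h3 := pow_le_pow_left₀ (norm_nonneg _) (hf.bound ⟨x, x.2⟩) 2
    rw [mul_pow, h1] at h3
    have h4 : ∑ i, ‖rightAnn i (f ⟨x, x.2⟩)‖ ^ 2 =
        ∑ i, ‖f ⟨rightAnn i x, (hmem x).1 x.1.2 i⟩‖ ^ 2 :=
      Finset.sum_congr rfl fun i _ => by rw [h2 i]
    rw [h4] at h3
    change _ ≤ C ^ 2 * ‖(x : Fock d)‖ ^ 2 at h3
    linarith)
  let A : Fin d → E →ₗ[ℂ] Fock d := fun i => f.toFun ∘ₗ
    (rightAnn i).toLinearMap.restrict (p := E) (q := f.domain) fun x hx => (hmem x).1 hx i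
  let F : E →ₗ[ℂ] Fock d := ∑ i, (rightReg (FreeMonoid.of i)).toLinearMap ∘ₗ A i +
    g.smulRight (basisVec 1)
  have hF : ∀ x : E, F x = ∑ i, rightReg (FreeMonoid.of i)
      (f ⟨rightAnn i x, (hmem x).1 x.2 i⟩) + g x • basisVec 1 := by
    intro x
    simp only [F, LinearMap.add_apply, LinearMap.sum_apply, LinearMap.smulRight_apply]
    rfl
  have hFf : ∀ (x : Fock d) (hx : x ∈ f.domain), f ⟨x, hx⟩ = F ⟨x, hle hx⟩ := by
    intro x hx
    rw [hF, eq_sum_rightReg (f ⟨x, hx⟩)]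
    congr 1
    · exact Finset.sum_congr rfl fun i _ => congrArg _ (hf.comm i ⟨x, hx⟩).symm
    · rw [show g ⟨x, hle hx⟩ = f ⟨x, hx⟩ 1 from (hg ⟨⟨x, hle hx⟩, hx⟩).trans (hφ _)]
  refine ⟨⟨E, F⟩, ⟨hle, ?_⟩, ⟨fun i x hx => hle ((hmem x).1 hx i), ?_, ?_⟩,
    fun x hx => (hmem x).2 hx⟩
  · rintro ⟨x, hx⟩ ⟨y, hy⟩ (rfl : x = y)
    exact hFf x hx
  · intro i x
    change F _ = rightAnn i (F x)
    rw [hF x, rightAnn_sum_rightReg]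
    exact (hFf _ _).symm
  · intro x
    change ‖F x‖ ≤ _
    refine le_of_sq_le_sq ?_ (mul_nonneg hC (norm_nonneg _))
    rw [norm_sq_eq_sum_rightAnn, hF x, sum_rightReg_apply_one]
    simp only [rightAnn_sum_rightReg]
    have := hgb x
    rw [hre] at this
    rw [mul_pow]
    change _ ≤ C ^ 2 * ‖(x : Fock d)‖ ^ 2
    linarith

theorem isPartialIntertwiner_sSup {d : ℕ} {C : ℝ} {c : Set (Fock d →ₗ.[ℂ] Fock d)}
    (hne : c.Nonempty) (hc : DirectedOn (· ≤ ·) c) (h : ∀ f ∈ c, IsPartialIntertwiner C f) :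
    IsPartialIntertwiner C (LinearPMap.sSup c hc) := by
  have hinv : ∀ i, ∀ x ∈ (LinearPMap.sSup c hc).domain,
      rightAnn i x ∈ (LinearPMap.sSup c hc).domain := by
    intro i x hx
    obtain ⟨f, hf, hxf⟩ := (LinearPMap.mem_domain_sSup_iff hne hc).1 hx
    exact (LinearPMap.mem_domain_sSup_iff hne hc).2 ⟨f, hf, (h f hf).invariant i x hxf⟩
  refine ⟨hinv, ?_, ?_⟩
  · rintro i ⟨x, hx⟩
    obtain ⟨f, hf, hxf⟩ := (LinearPMap.mem_domain_sSup_iff hne hc).1 hx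
    have h1 := LinearPMap.sSup_apply hc hf ⟨x, hxf⟩
    have h2 := LinearPMap.sSup_apply hc hf ⟨rightAnn i x, (h f hf).invariant i x hxf⟩
    exact h2.trans (((h f hf).comm i ⟨x, hxf⟩).trans (congrArg _ h1.symm))
  · rintro ⟨x, hx⟩
    obtain ⟨f, hf, hxf⟩ := (LinearPMap.mem_domain_sSup_iff hne hc).1 hx
    have h1 := LinearPMap.sSup_apply hc hf ⟨x, hxf⟩
    exact (congrArg norm h1).trans_le ((h f hf).bound ⟨x, hxf⟩)

theorem dense_span_basisVec (ι : Type) :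
    (Submodule.span ℂ (Set.range (basisVec : ι → L2 ι))).topologicalClosure = ⊤ := by
  rw [Submodule.topologicalClosure_eq_top_iff, Submodule.eq_bot_iff]
  intro x hx
  refine ext_coord fun i => ?_
  rw [← inner_basisVec_left]
  exact (Submodule.mem_orthogonal _ _).1 hx _ (Submodule.subset_span ⟨i, rfl⟩)

/-- An operator on a coinvariant subspace which commutes with the right annihilation operators
extends to the whole Fock space. -/
theorem exists_intertwining_extension {d : ℕ} (N : Submodule ℂ (Fock d)) (X : N →L[ℂ] Fock d)
    (hN : ∀ i, ∀ x ∈ N, rightAnn i x ∈ N)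
    (hX : ∀ i (x : N), X ⟨rightAnn i x, hN i x x.2⟩ = rightAnn i (X x)) :
    ∃ Y : Op (Fock d), (∀ x : N, Y x = X x) ∧
      ∀ i x, Y (rightAnn i x) = rightAnn i (Y x) := by
  let f₀ : Fock d →ₗ.[ℂ] Fock d := ⟨N, X.toLinearMap⟩
  have h₀ : IsPartialIntertwiner ‖X‖ f₀ := ⟨hN, hX, fun x => X.le_opNorm x⟩
  obtain ⟨f, hf₀, hmax⟩ := zorn_le_nonempty₀ {f | IsPartialIntertwiner ‖X‖ f}
    (fun c hc hchain y hy => ⟨LinearPMap.sSup c hchain.directedOn,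
      isPartialIntertwiner_sSup ⟨y, hy⟩ _ hc, fun z hz => LinearPMap.le_sSup _ hz⟩) f₀ h₀
  have hf : IsPartialIntertwiner ‖X‖ f := hmax.prop
  -- By maximality the one-step extension adds nothing, so the domain is closed under passing from
  -- all `aᵢ x` to `x`.
  have hdom : ∀ x, (∀ i, rightAnn i x ∈ f.domain) → x ∈ f.domain := by
    obtain ⟨f', hff', hf', hd⟩ := hf.exists_extension (norm_nonneg X)
    exact fun x hx => (hmax.le_of_ge hf' hff').1 (hd x hx)
  -- Each `aᵢ` deletes a final letter `i` or kills `ξ_w`, so induction on the length puts every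
  -- basis vector in the domain, which is therefore dense.
  have hbasis : ∀ w : Word d, basisVec w ∈ f.domain := by
    intro w
    induction hn : w.length generalizing w with
    | zero =>
      rw [FreeMonoid.length_eq_zero.1 hn]
      refine hdom _ fun i => ?_
      have : rightAnn i (basisVec 1 : Fock d) = 0 := ext_coord fun v => by
        rw [rightAnn_apply, basisVec_apply_ne (mul_of_ne_one v i)]; rfl
      rw [this]
      exact zero_mem _
    | succ n ih =>
      refine hdom _ fun i => ?_
      by_cases hw : ∃ v, w = v * FreeMonoid.of i
      · obtain ⟨v, rfl⟩ := hw
        have : rightAnn i (basisVec (v * FreeMonoid.of i) : Fock d) = basisVec v := by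
          refine ext_coord fun u => ?_
          rw [rightAnn_apply]
          by_cases huv : u = v
          · subst huv; rw [basisVec_apply_self, basisVec_apply_self]
          · rw [basisVec_apply_ne huv, basisVec_apply_ne]
            exact fun h => huv (mul_of_inj h).1
        rw [this]
        refine ih v ?_
        rw [FreeMonoid.length_mul, FreeMonoid.length_of] at hn
        omega
      · have : rightAnn i (basisVec w : Fock d) = 0 := ext_coord fun v => by
          rw [rightAnn_apply, basisVec_apply_ne fun h => hw ⟨v, h.symm⟩]; rfl
        rw [this]
        exact zero_mem _
  have hdense : Dense (f.domain : Set (Fock d)) := by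
    rw [Submodule.dense_iff_topologicalClosure_eq_top, eq_top_iff, ← dense_span_basisVec]
    refine Submodule.topologicalClosure_mono (Submodule.span_le.2 ?_)
    rintro _ ⟨w, rfl⟩
    exact hbasis w
  let g : f.domain →L[ℂ] Fock d := f.toFun.mkContinuous ‖X‖ hf.bound
  have hY : ∀ x : f.domain, g.extend f.domain.subtypeL x = f x :=
    g.extend_eq (e := f.domain.subtypeL) hdense.denseRange_val
      isUniformEmbedding_subtype_val.isUniformInducing
  refine ⟨g.extend f.domain.subtypeL, fun x => ?_, fun i x => ?_⟩
  · have hx : (x : Fock d) ∈ f.domain := hf₀.1 x.2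
    rw [hY ⟨x, hx⟩]
    exact (hf₀.2 (x := x) (y := ⟨x, hx⟩) rfl).symm
  · refine congrFun (Continuous.ext_on hdense
      (f := fun x => g.extend f.domain.subtypeL (rightAnn i x))
      (g := fun x => rightAnn i (g.extend f.domain.subtypeL x)) (by fun_prop) (by fun_prop) ?_) x
    intro x hx
    change g.extend f.domain.subtypeL (rightAnn i x) =
      rightAnn i (g.extend f.domain.subtypeL x)
    rw [hY ⟨x, hx⟩, hY ⟨_, hf.invariant i x hx⟩]
    exact hf.comm i ⟨x, hx⟩

/-! ### The free semigroup algebra is the commutant of the right regular representation -/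

/-- The uniform bound makes the functionals equicontinuous, so the vectors at which they converge to
`ψ` form a closed subspace. -/
theorem tendsto_of_bounded_of_basisVec {ι : Type} {φ : ℕ → L2 ι →L[ℂ] ℂ} {ψ : L2 ι →L[ℂ] ℂ}
    {C : ℝ} (hC : ∀ k, ‖φ k‖ ≤ C)
    (h : ∀ i, Filter.Tendsto (fun k => φ k (basisVec i)) Filter.atTop (nhds (ψ (basisVec i))))
    (x : L2 ι) : Filter.Tendsto (fun k => φ k x) Filter.atTop (nhds (ψ x)) := by
  have heq : Equicontinuous fun k => (φ k : L2 ι → ℂ) :=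
    (LipschitzWith.uniformEquicontinuous _ C.toNNReal fun k =>
      (φ k).lipschitz.weaken (NNReal.coe_le_coe.1 ((hC k).trans (Real.le_coe_toNNReal C)))
      ).equicontinuous
  let S : Submodule ℂ (L2 ι) :=
    { carrier := {x | Filter.Tendsto (fun k => φ k x) Filter.atTop (nhds (ψ x))}
      add_mem' := fun {x y} hx hy => by
        simpa only [Set.mem_ofPred_eq, map_add] using hx.add hy
      zero_mem' := by simp
      smul_mem' := fun c x hx => by
        simpa only [Set.mem_ofPred_eq, map_smul] using hx.const_smul c }
  have hcl : IsClosed (S : Set (L2 ι)) := heq.isClosed_setOfPred_tendsto ψ.continuous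
  have htop : (⊤ : Submodule ℂ (L2 ι)) ≤ S := by
    rw [← dense_span_basisVec]
    refine Submodule.topologicalClosure_minimal _ (Submodule.span_le.2 ?_) hcl
    rintro _ ⟨i, rfl⟩
    exact h i
  exact htop (Submodule.mem_top (x := x))

/-- Bounded sequences of operators whose matrix coefficients converge are convergent in the weak
operator topology. -/
theorem tendsto_wot_of_matrix {ι : Type} {T : ℕ → Op (L2 ι)} {A : Op (L2 ι)} {C : ℝ}
    (hC : ∀ k, ‖T k‖ ≤ C)
    (h : ∀ i j, Filter.Tendsto (fun k => T k (basisVec i) j) Filter.atTop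
      (nhds (A (basisVec i) j))) :
    Filter.Tendsto (fun k => ContinuousLinearMapWOT.ofCLM (T k)) Filter.atTop
      (nhds (ContinuousLinearMapWOT.ofCLM A)) := by
  rw [ContinuousLinearMapWOT.tendsto_iff_forall_inner_apply_tendsto]
  intro x y
  have h1 : ∀ j, Filter.Tendsto (fun k => T k x j) Filter.atTop (nhds (A x j)) := by
    intro j
    have := tendsto_of_bounded_of_basisVec
      (φ := fun k => innerSL ℂ (basisVec j : L2 ι) ∘L T k)
      (ψ := innerSL ℂ (basisVec j : L2 ι) ∘L A) (C := C) (fun k => by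
        refine (ContinuousLinearMap.opNorm_comp_le _ _).trans ?_
        rw [innerSL_apply_norm, (orthonormal_basisVec ι).1 j, one_mul]
        exact hC k) (fun i => by
        simpa only [ContinuousLinearMap.comp_apply, innerSL_apply_apply, inner_basisVec_left]
          using h i j) x
    simpa only [ContinuousLinearMap.comp_apply, innerSL_apply_apply, inner_basisVec_left]
      using this
  -- The same density argument is used a second time, in `y` with `x` fixed. The functional linear
  -- in `y` is `⟪T k x, y⟫`, hence the conjugations before and after.
  have h2 := tendsto_of_bounded_of_basisVec
    (φ := fun k => innerSL ℂ (T k x)) (ψ := innerSL ℂ (A x)) (C := C * ‖x‖) (fun k => by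
      rw [innerSL_apply_norm]
      exact (T k).le_of_opNorm_le (hC k) x) (fun j => by
      simp only [innerSL_apply_apply]
      simp only [← inner_conj_symm _ (basisVec j), inner_basisVec_left]
      exact (Complex.continuous_conj.tendsto _).comp (h1 j)) y
  have h3 := (Complex.continuous_conj.tendsto _).comp h2
  simpa only [Function.comp_def, innerSL_apply_apply, inner_conj_symm,
    ContinuousLinearMapWOT.ofCLM_apply] using h3

theorem norm_ampliation_le {κ ι τ : Type} (g : κ → ι → τ)
    (hg : Function.Injective (Function.uncurry g)) (A : Op (L2 ι)) :
    ‖ampliation g hg A‖ ≤ ‖A‖ := by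
  set W := (orthogonalFamily_reindex g hg).linearIsometry.toContinuousLinearMap with hW
  have hW1 : ‖W‖ ≤ 1 := LinearIsometry.norm_toContinuousLinearMap_le _
  have hW2 : ‖ContinuousLinearMap.adjoint W‖ ≤ 1 := by
    rwa [LinearIsometryEquiv.norm_map]
  refine ContinuousLinearMap.opNorm_le_bound _ (norm_nonneg A) fun x => ?_
  change ‖W (lp.mapCLM 2 (fun _ : κ => A) (norm_nonneg A) (fun _ => le_rfl)
    (ContinuousLinearMap.adjoint W x))‖ ≤ _
  calc _ ≤ 1 * ‖_‖ := W.le_of_opNorm_le hW1 _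
    _ ≤ 1 * (‖A‖ * ‖ContinuousLinearMap.adjoint W x‖) := by
      gcongr
      exact ContinuousLinearMap.le_of_opNorm_le _ (lp.norm_mapCLM_le _ _ _ _) _
    _ ≤ 1 * (‖A‖ * (1 * ‖x‖)) := by
      gcongr
      exact ContinuousLinearMap.le_of_opNorm_le _ hW2 _
    _ = ‖A‖ * ‖x‖ := by ring

theorem finite_setOf_length_lt (d k : ℕ) : {w : Word d | w.length < k}.Finite :=
  List.finite_length_lt (Fin d) k

theorem finite_setOf_length_eq (d k : ℕ) : {w : Word d | w.length = k}.Finite :=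
  List.finite_length_eq (Fin d) k

/-- Operators in the commutant of the right regular representation are determined by their value
on the vacuum. -/
theorem apply_basisVec_of_commute {d : ℕ} {A : Op (Fock d)}
    (hA : ∀ v, A * rightReg v = rightReg v * A) (w : Word d) :
    A (basisVec w) = rightReg w (A (basisVec 1)) := by
  have h : A (rightReg w (basisVec 1)) = rightReg w (A (basisVec 1)) :=
    congrArg (fun T : Op (Fock d) => T (basisVec 1)) (hA w)
  rwa [rightReg_basisVec, one_mul] at h

/-! ### Cesàro means and their contractivity -/

/-- The Cesàro means `∑_{|v| < k} (1 - |v| / k) a_v L_v` of `A ∼ ∑ a_v L_v`. -/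
def cesaro {d : ℕ} (A : Op (Fock d)) (k : ℕ) : Op (Fock d) :=
  ∑ v ∈ (finite_setOf_length_lt d k).toFinset,
    ((((k - v.length : ℕ) : ℂ) / k) * A (basisVec 1) v) • leftReg (v : WithZero (Word d))

/-- Truncated subtraction makes the weight zero for `|v| ≥ k`, so no restriction on `v` is needed.
-/
theorem cesaro_basisVec_apply_mul {d : ℕ} (A : Op (Fock d)) (k : ℕ) (v w : Word d) :
    cesaro A k (basisVec w) (v * w) = (((k - v.length : ℕ) : ℂ) / k) * A (basisVec 1) v := by
  simp only [cesaro, _root_.sum_apply, sum_coord, _root_.smul_apply,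
    lp.coeFn_smul, Pi.smul_apply, leftReg_basisVec, smul_eq_mul]
  by_cases hv : v.length < k
  · rw [Finset.sum_eq_single v, basisVec_apply_self, mul_one]
    · intro u _ hu
      rw [basisVec_apply_ne fun h => hu (mul_right_cancel h).symm, mul_zero]
    · intro h
      exact absurd ((finite_setOf_length_lt d k).mem_toFinset.2 hv) h
  · rw [Finset.sum_eq_zero, Nat.sub_eq_zero_of_le (not_lt.1 hv)]
    · simp
    · intro u hu
      have hu' : u.length < k := (finite_setOf_length_lt d k).mem_toFinset.1 hu
      rw [basisVec_apply_ne, mul_zero]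
      intro h
      rw [mul_right_cancel h] at hv
      exact hv hu'

theorem cesaro_basisVec_apply_ne {d : ℕ} (A : Op (Fock d)) (k : ℕ) (u w : Word d)
    (h : ∀ v, v * w ≠ u) : cesaro A k (basisVec w) u = 0 := by
  simp only [cesaro, _root_.sum_apply, sum_coord, _root_.smul_apply,
    lp.coeFn_smul, Pi.smul_apply, leftReg_basisVec, smul_eq_mul]
  exact Finset.sum_eq_zero fun v _ => by rw [basisVec_apply_ne (h v).symm, mul_zero]

/-- The vectors `k^{-1/2} ∑_{j<k} ξ_w ⊗ e_{|w|+j}`. -/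
def windowVec {d : ℕ} (k : ℕ) (w : Word d) : L2 (Word d × ℕ) :=
  (((Real.sqrt k)⁻¹ : ℝ) : ℂ) • ∑ j ∈ Finset.range k, basisVec (w, w.length + j)

theorem inv_sqrt_mul_self (k : ℕ) :
    (((Real.sqrt k)⁻¹ : ℝ) : ℂ) * (((Real.sqrt k)⁻¹ : ℝ) : ℂ) = (k : ℂ)⁻¹ := by
  rw [← Complex.ofReal_mul, ← mul_inv, Real.mul_self_sqrt (Nat.cast_nonneg _)]
  simp

theorem orthonormal_windowVec {d : ℕ} {k : ℕ} (hk : k ≠ 0) :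
    Orthonormal ℂ (windowVec k : Word d → L2 (Word d × ℕ)) := by
  classical
  rw [orthonormal_iff_ite]
  intro u w
  simp only [windowVec, inner_smul_left, inner_smul_right, Complex.conj_ofReal, sum_inner,
    inner_sum, orthonormal_iff_ite.1 (orthonormal_basisVec (Word d × ℕ))]
  by_cases h : u = w
  · subst h
    have : ∀ i ∈ Finset.range k, (∑ j ∈ Finset.range k,
        if (u, u.length + j) = (u, u.length + i) then (1 : ℂ) else 0) = 1 := by
      intro i hi
      simp only [Prod.mk.injEq, true_and, Nat.add_left_cancel_iff]
      rw [Finset.sum_ite_eq' , if_pos hi]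
    rw [if_pos rfl]
    rw [← Finset.mul_sum, Finset.sum_congr rfl this, Finset.sum_const, Finset.card_range, nsmul_eq_mul, mul_one, ← mul_assoc,
      inv_sqrt_mul_self, inv_mul_cancel₀ (Nat.cast_ne_zero.2 hk)]
  · simp [h]

theorem sum_range_ite_eq_add (m k : ℕ) :
    ∑ i ∈ Finset.range k, ∑ j ∈ Finset.range k, (if m + i = j then (1 : ℂ) else 0) =
      ((k - m : ℕ) : ℂ) := by
  simp only [Finset.sum_ite_eq, Finset.mem_range, Finset.sum_boole]
  congr 1
  rw [show (Finset.range k).filter (fun i => m + i < k) = Finset.range (k - m) by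
    ext i; simp only [Finset.mem_filter, Finset.mem_range]; omega, Finset.card_range]

/-- With the isometry `V ξ_w = windowVec k w`, the Cesàro mean is `V* (A ⊗ 1) V`, so its norm is at
most `‖A‖`. Indeed the coefficient of `A` from `ξ_w` to `ξ_{vw}` gets multiplied by the overlap of
the windows starting at `|w|` and `|v| + |w|`, which is the Fejér weight `(k - |v|)₊ / k`. -/
theorem norm_cesaro_le {d : ℕ} {A : Op (Fock d)} (hA : ∀ v, A * rightReg v = rightReg v * A)
    {k : ℕ} (hk : k ≠ 0) : ‖cesaro A k‖ ≤ ‖A‖ := by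
  have hg : Function.Injective (Function.uncurry fun (n : ℕ) (w : Word d) => (w, n)) :=
    fun _ _ h => Prod.swap_injective h
  let V : Fock d →ₗᵢ[ℂ] L2 (Word d × ℕ) :=
    (orthonormal_windowVec hk).orthogonalFamily.linearIsometry
  have hV : ∀ w, V (basisVec w) = windowVec k w := by
    intro w
    simp only [V, basisVec]
    rw [OrthogonalFamily.linearIsometry_apply_single]
    simp
  set W := V.toContinuousLinearMap with hW
  have hW1 : ‖W‖ ≤ 1 := LinearIsometry.norm_toContinuousLinearMap_le _
  have hW2 : ‖ContinuousLinearMap.adjoint W‖ ≤ 1 := by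
    rwa [LinearIsometryEquiv.norm_map]
  have key : cesaro A k = ContinuousLinearMap.adjoint W ∘L ampliation _ hg A ∘L W := by
    apply op_ext_basisVec
    intro w
    refine ext_coord fun u => ?_
    have h1 : ∀ n, ampliation _ hg A (basisVec (w, n)) =
        reindex (fun w : Word d => (w, n)) (injective_slice hg n) (A (basisVec w)) :=
      fun n => ampliation_basisVec _ hg A n w
    have h2 : ∀ m n, inner ℂ (basisVec (u, m)) (ampliation _ hg A (basisVec (w, n))) =
        if m = n then A (basisVec w) u else 0 := by
      intro m n
      rw [h1, inner_basisVec_left]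
      split_ifs with hmn
      · subst hmn
        exact reindex_apply (fun w : Word d => (w, m)) _ _ u
      · exact reindex_apply_eq_zero _ _ _ _ fun v hv => hmn (Prod.ext_iff.1 hv).2.symm
    have h3 : (ContinuousLinearMap.adjoint W ∘L ampliation _ hg A ∘L W) (basisVec w) u =
        (k : ℂ)⁻¹ * ∑ i ∈ Finset.range k, ∑ j ∈ Finset.range k,
          if u.length + i = w.length + j then A (basisVec w) u else 0 := by
      rw [← inner_basisVec_left, ContinuousLinearMap.comp_apply, ContinuousLinearMap.comp_apply,
        ContinuousLinearMap.adjoint_inner_right]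
      change inner ℂ (V (basisVec u)) (ampliation _ hg A (V (basisVec w))) = _
      rw [hV, hV, windowVec, windowVec, map_smul, inner_smul_left, inner_smul_right,
        Complex.conj_ofReal, ← mul_assoc, inv_sqrt_mul_self, map_sum, sum_inner]
      simp only [inner_sum, h2]
    rw [h3]
    by_cases huw : ∃ v, v * w = u
    · obtain ⟨v, rfl⟩ := huw
      rw [cesaro_basisVec_apply_mul, apply_basisVec_of_commute hA w, rightReg_apply_mul,
        FreeMonoid.length_mul]
      have h4 : ∀ i j : ℕ, (if v.length + w.length + i = w.length + j then A (basisVec 1) v else 0)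
          = (if v.length + i = j then (1 : ℂ) else 0) * A (basisVec 1) v := by
        intro i j
        rw [ite_mul, one_mul, zero_mul]
        congr 1
        rw [eq_iff_iff]
        omega
      simp only [h4, ← Finset.sum_mul, sum_range_ite_eq_add]
      ring
    · push Not at huw
      rw [cesaro_basisVec_apply_ne A k u w huw, apply_basisVec_of_commute hA w]
      have : rightReg w (A (basisVec 1)) u = 0 :=
        reindex_apply_eq_zero _ (mul_left_injective w) _ _ huw
      simp [this]
  rw [key]
  refine ContinuousLinearMap.opNorm_le_bound _ (norm_nonneg A) fun x => ?_
  calc _ ≤ 1 * ‖ampliation _ hg A (W x)‖ := ContinuousLinearMap.le_of_opNorm_le _ hW2 _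
    _ ≤ 1 * (‖A‖ * ‖W x‖) := by
      gcongr
      exact ContinuousLinearMap.le_of_opNorm_le _ (norm_ampliation_le _ hg A) _
    _ ≤ 1 * (‖A‖ * (1 * ‖x‖)) := by
      gcongr
      exact ContinuousLinearMap.le_of_opNorm_le _ hW1 _
    _ = ‖A‖ * ‖x‖ := by ring

theorem tendsto_natSub_div (m : ℕ) :
    Filter.Tendsto (fun k : ℕ => (((k - m : ℕ) : ℂ) / k)) Filter.atTop (nhds 1) := by
  have h1 : Filter.Tendsto (fun k : ℕ => (1 : ℂ) - m / k) Filter.atTop (nhds (1 - 0)) :=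
    tendsto_const_nhds.sub (tendsto_const_div_atTop_nhds_zero_nat (m : ℂ))
  rw [sub_zero] at h1
  refine h1.congr' ?_
  filter_upwards [Filter.eventually_ge_atTop (max m 1)] with k hk
  have hk0 : (k : ℂ) ≠ 0 := by
    have : 1 ≤ k := le_of_max_le_right hk
    exact_mod_cast (by omega : k ≠ 0)
  rw [Nat.cast_sub (le_of_max_le_left hk)]
  field_simp

/-- Left and right multiplications commute and commutants are WOT-closed. Conversely, the Cesàro
means of `A` are polynomials in the `L_v`, bounded by `‖A‖`, whose matrix coefficients converge to
those of `A`. -/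
theorem mem_freeAlg_iff {d : ℕ} {A : Op (Fock d)} :
    A ∈ freeAlg d ↔ ∀ v, A * rightReg v = rightReg v * A := by
  constructor
  · intro hA v
    refine commute_of_mem_wotClosure (fun B hB => ?_) hA
    refine Algebra.adjoin_induction (p := fun B _ => B * rightReg v = rightReg v * B)
      ?_ ?_ ?_ ?_ hB
    · rintro _ ⟨u, rfl⟩
      exact leftReg_commute_rightReg u v
    · intro r
      exact Algebra.commutes r _
    · intro x y _ _ hx hy
      rw [add_mul, mul_add, hx, hy]
    · intro x y _ _ hx hy
      rw [mul_assoc, hy, ← mul_assoc, hx, mul_assoc]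
  · intro hA
    have hmem : ∀ k, cesaro A k ∈
        (Algebra.adjoin ℂ (Set.range fun u : Word d => leftReg (u : WithZero (Word d)))) :=
      fun k => Subalgebra.sum_mem _ fun v _ =>
        Subalgebra.smul_mem _ (Algebra.subset_adjoin (Set.mem_range_self v)) _
    -- The index is shifted to `k + 1` because the norm bound excludes `0`.
    have hlim : Filter.Tendsto
        (fun k => ContinuousLinearMapWOT.ofCLM (cesaro A (k + 1))) Filter.atTop
        (nhds (ContinuousLinearMapWOT.ofCLM A)) := by
      refine tendsto_wot_of_matrix (C := ‖A‖) (fun k => norm_cesaro_le hA k.succ_ne_zero) ?_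
      intro w u
      by_cases huw : ∃ v, v * w = u
      · obtain ⟨v, rfl⟩ := huw
        simp only [cesaro_basisVec_apply_mul]
        rw [apply_basisVec_of_commute hA w, rightReg_apply_mul]
        have := ((tendsto_natSub_div v.length).comp
          (Filter.tendsto_add_atTop_nat 1)).mul_const (A (basisVec 1) v)
        rw [one_mul] at this
        exact this
      · push Not at huw
        simp only [cesaro_basisVec_apply_ne A _ u w huw]
        rw [apply_basisVec_of_commute hA w]
        have : rightReg w (A (basisVec 1)) u = 0 :=
        reindex_apply_eq_zero _ (mul_left_injective w) _ _ huw
        rw [this]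
        exact tendsto_const_nhds
    exact mem_closure_of_tendsto hlim
      (Filter.Eventually.of_forall fun k => Set.mem_image_of_mem _ (hmem (k + 1)))

/-! ### The coinvariant subspace of a homogeneous Hopf ideal -/

theorem mem_coinvariant_iff {d : ℕ} {J : Submodule ℂ (Op (Fock d))} {f : Fock d} :
    f ∈ coinvariant J ↔ ∀ A ∈ J, inner ℂ f (A (basisVec 1)) = 0 := by
  rw [coinvariant, Submodule.mem_orthogonal']
  constructor
  · intro h A hA
    exact h _ ⟨A, hA, rfl⟩
  · rintro h _ ⟨A, hA, rfl⟩
    exact h A hA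

theorem homogeneousPart_apply {d n : ℕ} {A : Op (Fock d)} (hA : A ∈ homogeneousPart d n)
    {w : Word d} (hw : w.length ≠ n) : A (basisVec 1) w = 0 := by
  refine Submodule.span_induction (p := fun A _ => A (basisVec 1) w = 0) ?_ ?_ ?_ ?_ hA
  · rintro _ ⟨u, hu, rfl⟩
    rw [leftReg_basisVec, mul_one, basisVec_apply_ne]
    rintro rfl
    exact hw hu
  · rfl
  · intro A B _ _ h1 h2
    rw [_root_.add_apply, lp.coeFn_add, Pi.add_apply, h1, h2, add_zero]
  · intro a A _ h
    rw [_root_.smul_apply, lp.coeFn_smul, Pi.smul_apply, h, smul_zero]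

theorem homogeneousPart_subset_freeAlg {d n : ℕ} {A : Op (Fock d)}
    (hA : A ∈ homogeneousPart d n) : A ∈ freeAlg d := by
  apply subset_wotClosure
  refine (Submodule.span_le (p := Subalgebra.toSubmodule (Algebra.adjoin ℂ
    (Set.range fun u : Word d => leftReg (u : WithZero (Word d)))))).2 ?_ hA
  rintro _ ⟨w, -, rfl⟩
  exact Algebra.subset_adjoin ⟨w, rfl⟩

/-- Orthogonality of `f` to `A ξ_∅` is a WOT-closed linear condition on `A`, so it may be tested on
the homogeneous elements that generate `J`. -/
theorem mem_coinvariant_iff_homogeneous {d : ℕ} {J : Submodule ℂ (Op (Fock d))}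
    (hJ : IsHomogeneous J) {f : Fock d} :
    f ∈ coinvariant J ↔
      ∀ n, ∀ A ∈ J ⊓ homogeneousPart d n, inner ℂ f (A (basisVec 1)) = 0 := by
  rw [mem_coinvariant_iff]
  refine ⟨fun h n A hA => h A hA.1, fun h A hA => ?_⟩
  have hA' : A ∈ (J : Set (Op (Fock d))) := hA
  rw [hJ] at hA'
  have h0 : inner ℂ f (A (basisVec 1)) = inner ℂ (0 : Fock d) (A (basisVec 1)) := by
    refine wotClosure_induction (fun B hB => ?_) hA'
    rw [inner_zero_left]
    refine Submodule.iSup_induction (fun n => J ⊓ homogeneousPart d n)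
      (motive := fun B => inner ℂ f (B (basisVec 1)) = 0) hB h ?_ ?_
    · exact inner_zero_right _
    · intro B C h1 h2
      rw [_root_.add_apply, inner_add_right, h1, h2, add_zero]
  rw [h0, inner_zero_left]

/-- The finite set of words of length `n`. -/
def wordsOfLength (d n : ℕ) : Finset (Word d) := (finite_setOf_length_eq d n).toFinset

theorem mem_wordsOfLength {d n : ℕ} {w : Word d} : w ∈ wordsOfLength d n ↔ w.length = n :=
  (finite_setOf_length_eq d n).mem_toFinset

theorem sum_smul_basisVec_apply {ι : Type} [DecidableEq ι] (F : Finset ι) (a : ι → ℂ) (i : ι) :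
    (∑ j ∈ F, a j • basisVec j : L2 ι) i = if i ∈ F then a i else 0 := by
  rw [sum_coord]
  simp only [lp.coeFn_smul, Pi.smul_apply, smul_eq_mul]
  split_ifs with h
  · rw [Finset.sum_eq_single_of_mem i h, basisVec_apply_self, mul_one]
    intro j _ hj
    rw [basisVec_apply_ne hj.symm, mul_zero]
  · refine Finset.sum_eq_zero fun j hj => ?_
    rw [basisVec_apply_ne, mul_zero]
    rintro rfl
    exact h hj

theorem inner_sum_smul_basisVec {ι : Type} (F : Finset ι) (a : ι → ℂ) (x : L2 ι) :
    inner ℂ (∑ j ∈ F, a j • basisVec j : L2 ι) x = ∑ j ∈ F, starRingEnd ℂ (a j) * x j := by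
  simp only [sum_inner, inner_smul_left, inner_basisVec_left]

theorem eq_sum_smul_basisVec {ι : Type} (F : Finset ι) (f : L2 ι) (h : ∀ i ∉ F, f i = 0) :
    f = ∑ i ∈ F, f i • basisVec i := by
  classical
  refine ext_coord fun i => ?_
  rw [sum_smul_basisVec_apply]
  split_ifs with hi
  · rfl
  · exact h i hi

theorem inner_eq_sum_of_support_left {ι : Type} (F : Finset ι) (f x : L2 ι)
    (h : ∀ i ∉ F, f i = 0) : inner ℂ f x = ∑ i ∈ F, starRingEnd ℂ (f i) * x i := by
  conv_lhs => rw [eq_sum_smul_basisVec F f h]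
  exact inner_sum_smul_basisVec _ _ _

theorem inner_eq_sum_of_support_right {ι : Type} (F : Finset ι) (f x : L2 ι)
    (h : ∀ i ∉ F, x i = 0) : inner ℂ f x = ∑ i ∈ F, starRingEnd ℂ (f i) * x i := by
  rw [← inner_conj_symm, inner_eq_sum_of_support_left F x f h, map_sum]
  refine Finset.sum_congr rfl fun i _ => ?_
  rw [map_mul, Complex.conj_conj, mul_comm]

/-- The homogeneous component of degree `n` of a vector of the Fock space. -/
def homogProj {d : ℕ} (n : ℕ) (f : Fock d) : Fock d :=
  ∑ w ∈ wordsOfLength d n, f w • basisVec w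

theorem homogProj_apply_eq {d n : ℕ} (f : Fock d) {w : Word d} (hw : w.length = n) :
    homogProj n f w = f w := by
  classical
  rw [homogProj, sum_smul_basisVec_apply, if_pos (mem_wordsOfLength.2 hw)]

theorem homogProj_apply_ne {d n : ℕ} (f : Fock d) {w : Word d} (hw : w.length ≠ n) :
    homogProj n f w = 0 := by
  classical
  rw [homogProj, sum_smul_basisVec_apply, if_neg (fun h => hw (mem_wordsOfLength.1 h))]

/-- Against a symbol of degree `m` the component pairs as `f` does if `m = n`, and to zero
otherwise. -/
theorem homogProj_mem_coinvariant {d : ℕ} {J : Submodule ℂ (Op (Fock d))}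
    (hJ : IsHomogeneous J) (n : ℕ) {f : Fock d} (hf : f ∈ coinvariant J) :
    homogProj n f ∈ coinvariant J := by
  rw [mem_coinvariant_iff_homogeneous hJ] at hf ⊢
  intro m A hA
  rw [homogProj, inner_sum_smul_basisVec]
  by_cases hm : m = n
  · subst hm
    rw [← hf m A hA, inner_eq_sum_of_support_right (wordsOfLength d m)]
    exact fun w hw => homogeneousPart_apply hA.2 fun h => hw (mem_wordsOfLength.2 h)
  · refine Finset.sum_eq_zero fun w hw => ?_
    rw [homogeneousPart_apply hA.2, mul_zero]
    rw [mem_wordsOfLength.1 hw]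
    exact Ne.symm hm

/-- A homogeneous operator belongs to `J` as soon as its symbol is orthogonal to `N_J`. -/
theorem mem_of_inner_coinvariant_eq_zero {d : ℕ} {J : Submodule ℂ (Op (Fock d))}
    (hJ : IsHomogeneous J) {n : ℕ} {T : Op (Fock d)} (hT : T ∈ homogeneousPart d n)
    (h : ∀ f ∈ coinvariant J, inner ℂ f (T (basisVec 1)) = 0) : T ∈ J := by
  let ev : Op (Fock d) →ₗ[ℂ] Fock d :=
    (ContinuousLinearMap.apply ℂ (Fock d) (basisVec (1 : Word d))).toLinearMap
  have hfin : FiniteDimensional ℂ (homogeneousPart d n) := by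
    refine FiniteDimensional.span_of_finite ℂ (Set.Finite.subset
      ((finite_setOf_length_eq d n).image fun w : Word d => leftReg (w : WithZero (Word d))) ?_)
    rintro _ ⟨w, hw, rfl⟩
    exact ⟨w, hw, rfl⟩
  have hfin' : FiniteDimensional ℂ (J ⊓ homogeneousPart d n : Submodule ℂ (Op (Fock d))) :=
    Submodule.finiteDimensional_of_le inf_le_right
  let K : Submodule ℂ (Fock d) := (J ⊓ homogeneousPart d n).map ev
  have hKdeg : ∀ x ∈ K, ∀ w : Word d, w.length ≠ n → x w = 0 := by
    rintro _ ⟨A, hA, rfl⟩ w hw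
    exact homogeneousPart_apply hA.2 hw
  let y : Fock d := T (basisVec 1)
  -- The residual of the symbol `y` is supported in degree `n` and orthogonal to `K`, hence lies in
  -- `N`. Then `h` gives `⟪f, y⟫ = 0`, which forces `f = 0` and `y ∈ K`.
  let f : Fock d := y - K.starProjection y
  have hfK : ∀ x ∈ K, inner ℂ f x = 0 := fun x hx =>
    K.starProjection_inner_eq_zero y x hx
  have hfdeg : ∀ w : Word d, w.length ≠ n → f w = 0 := by
    intro w hw
    change (y - K.starProjection y : Fock d) w = 0
    rw [lp.coeFn_sub, Pi.sub_apply, homogeneousPart_apply hT hw,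
      hKdeg _ (K.starProjection_apply_mem y) w hw, sub_zero]
  have hfN : f ∈ coinvariant J := by
    rw [mem_coinvariant_iff_homogeneous hJ]
    intro m A hA
    by_cases hm : m = n
    · subst hm
      exact hfK _ ⟨A, hA, rfl⟩
    · rw [inner_eq_sum_of_support_left (wordsOfLength d n) f _
        fun w hw => hfdeg w fun h => hw (mem_wordsOfLength.2 h)]
      refine Finset.sum_eq_zero fun w hw => ?_
      rw [homogeneousPart_apply hA.2, mul_zero]
      rw [mem_wordsOfLength.1 hw]
      exact Ne.symm hm
  have hf0 : f = 0 := by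
    rw [← inner_self_eq_zero (𝕜 := ℂ)]
    change inner ℂ f (y - K.starProjection y) = 0
    rw [inner_sub_right, h f hfN, hfK _ (K.starProjection_apply_mem y), sub_zero]
  have hyK : y ∈ K := by
    rw [sub_eq_zero.1 hf0]
    exact K.starProjection_apply_mem y
  obtain ⟨B, hB, hBy⟩ := hyK
  -- Elements of `𝓛_d` are determined by their symbols.
  have hTB : T = B := by
    apply op_ext_basisVec
    intro w
    rw [apply_basisVec_of_commute (mem_freeAlg_iff.1 (homogeneousPart_subset_freeAlg hT)) w,
      apply_basisVec_of_commute (mem_freeAlg_iff.1 (homogeneousPart_subset_freeAlg hB.2)) w]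
    exact congrArg _ hBy.symm
  rw [hTB]
  exact hB.1

/-! ### The coideal condition and pointwise products -/

/-- A vector functional which vanishes on a set of operators vanishes on its weak*-closure. -/
theorem inner_eq_zero_of_mem_weakStarClosure {H : Type} [NormedAddCommGroup H]
    [InnerProductSpace ℂ H] {s : Set (Op H)} {x y : H} (h : ∀ T ∈ s, inner ℂ y (T x) = 0)
    {T : Op H} (hT : T ∈ weakStarClosure s) : inner ℂ y (T x) = 0 := by
  let := weakStarTopology H
  -- Sequences concentrated at index `0` reduce the defining series to one matrix coefficient.
  have hsum : ∀ A : Op H, ∑' n, inner ℂ ((lp.single 2 0 y : lp (fun _ : ℕ => H) 2) n)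
      (A ((lp.single 2 0 x : lp (fun _ : ℕ => H) 2) n)) = inner ℂ y (A x) := by
    intro A
    rw [tsum_eq_single 0]
    · simp
    · intro n hn
      simp [lp.single_apply, hn]
  have hc : Continuous fun A : Op H => inner ℂ y (A x) := by
    have h1 : Continuous (fun (A : Op H) (p : lp (fun _ : ℕ => H) 2 × lp (fun _ : ℕ => H) 2) =>
        ∑' n, inner ℂ (p.2 n) (A (p.1 n))) := continuous_induced_dom
    have h2 := (continuous_apply (lp.single 2 0 x, lp.single 2 0 y)).comp h1
    refine h2.congr fun A => hsum A
  exact closure_minimal (t := {A : Op H | inner ℂ y (A x) = 0}) h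
    (isClosed_eq hc continuous_const) hT

/-- The vector `ξ_∅ ⊗ ξ_∅` lies in the copy of the Fock space indexed by the coprime pair `(∅, ∅)`,
whose basis is the diagonal `ξ_w ⊗ ξ_w`. -/
theorem comul_basisVec_one_apply {d : ℕ} (A : Op (Fock d)) (u v : Word d) [Decidable (u = v)] :
    comul A (basisVec (1, 1)) (u, v) = if u = v then A (basisVec 1) u else 0 := by
  let c : CoprimePair d := ⟨(1, 1), fun w a b h => by
    have h1 := congrArg FreeMonoid.length (Prod.ext_iff.1 h).1
    simp only [FreeMonoid.length_one, FreeMonoid.length_mul] at h1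
    exact FreeMonoid.length_eq_zero.1 (by omega)⟩
  have h := ampliation_basisVec (fun (c : CoprimePair d) (w : Word d) => (w * c.1.1, w * c.1.2))
    (coprimePair_injective d) A c 1
  have h1 : comul A (basisVec (1, 1)) = reindex (fun w : Word d => (w * c.1.1, w * c.1.2))
      (injective_slice (coprimePair_injective d) c) (A (basisVec 1)) := h
  rw [h1]
  have hc : ∀ w : Word d, (w * c.1.1, w * c.1.2) = (w, w) := fun w =>
    Prod.ext (mul_one w) (mul_one w)
  split_ifs with huv
  · subst huv
    have := reindex_apply (fun w : Word d => (w * c.1.1, w * c.1.2))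
      (injective_slice (coprimePair_injective d) c) (A (basisVec 1)) u
    rwa [hc] at this
  · refine reindex_apply_eq_zero _ (injective_slice (coprimePair_injective d) c) _ _
      fun w hw => huv ?_
    have hw' := (hc w).symm.trans hw
    exact (Prod.ext_iff.1 hw').1.symm.trans (Prod.ext_iff.1 hw').2

/-- The coinvariant subspace of a coideal is closed under pointwise products of finitely supported
functions. -/
theorem exists_mul_mem_coinvariant {d : ℕ} {J : Submodule ℂ (Op (Fock d))} (hJ : IsCoideal J)
    (F : Finset (Word d)) {f g : Fock d} (hf : f ∈ coinvariant J) (hg : g ∈ coinvariant J)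
    (hfF : ∀ w ∉ F, f w = 0) (hgF : ∀ w ∉ F, g w = 0) :
    ∃ h ∈ coinvariant J, ∀ w, h w = f w * g w := by
  classical
  let h : Fock d := ∑ w ∈ F, (f w * g w) • basisVec w
  have hh : ∀ w, h w = f w * g w := by
    intro w
    rw [sum_smul_basisVec_apply F (fun w => f w * g w)]
    split_ifs with hw
    · rfl
    · rw [hfF w hw, zero_mul]
  refine ⟨h, ?_, hh⟩
  -- `Y = f ⊗ g`. Its pairing with `(B ⊗ C)(ξ_∅ ⊗ ξ_∅)` factors, hence vanishes if `B` or `C` is in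
  -- `J`; its pairing with `Δ(A)(ξ_∅ ⊗ ξ_∅)` sees only the diagonal and equals `⟪fg, A ξ_∅⟫`.
  let Y : L2 (Word d × Word d) := ∑ p ∈ F ×ˢ F, (f p.1 * g p.2) • basisVec p
  have hY : ∀ T : Op (L2 (Word d × Word d)), inner ℂ Y (T (basisVec (1, 1))) =
      ∑ u ∈ F, ∑ v ∈ F, starRingEnd ℂ (f u * g v) * T (basisVec (1, 1)) (u, v) := by
    intro T
    rw [inner_sum_smul_basisVec (F ×ˢ F) (fun p => f p.1 * g p.2), Finset.sum_product]
  have hYtensor : ∀ B C : Op (Fock d), inner ℂ Y (tensorOp B C (basisVec (1, 1))) =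
      inner ℂ f (B (basisVec 1)) * inner ℂ g (C (basisVec 1)) := by
    intro B C
    rw [hY, inner_eq_sum_of_support_left F f _ hfF, inner_eq_sum_of_support_left F g _ hgF,
      Finset.sum_mul_sum]
    refine Finset.sum_congr rfl fun u _ => Finset.sum_congr rfl fun v _ => ?_
    rw [tensorOp_basisVec_apply, map_mul]
    ring
  rw [mem_coinvariant_iff] at hf hg ⊢
  intro A hA
  have h1 : inner ℂ Y (comul A (basisVec (1, 1))) = inner ℂ h (A (basisVec 1)) := by
    rw [hY, inner_sum_smul_basisVec F (fun w => f w * g w)]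
    refine Finset.sum_congr rfl fun u hu => ?_
    simp only [comul_basisVec_one_apply, mul_ite, mul_zero]
    rw [Finset.sum_ite_eq, if_pos hu]
  rw [← h1]
  refine inner_eq_zero_of_mem_weakStarClosure (fun T hT => ?_) (hJ A hA)
  refine Submodule.span_induction
    (p := fun T _ => inner ℂ Y (T (basisVec ((1 : Word d), (1 : Word d)))) = 0) ?_ ?_ ?_ ?_ hT
  · rintro _ (⟨B, hB, C, -, rfl⟩ | ⟨B, -, C, hC, rfl⟩)
    · rw [hYtensor, hf B hB, zero_mul]
    · rw [hYtensor, hg C hC, mul_zero]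
  · exact inner_zero_right _
  · intro S T _ _ h1 h2
    rw [_root_.add_apply, inner_add_right, h1, h2, add_zero]
  · intro a T _ h
    rw [_root_.smul_apply, inner_smul_right, h, mul_zero]

/-! ### The congruence of a homogeneous Hopf ideal -/

theorem inner_basisVec_right {ι : Type} (f : L2 ι) (i : ι) :
    inner ℂ f (basisVec i) = starRingEnd ℂ (f i) := by
  rw [← inner_conj_symm, inner_basisVec_left]

theorem leftReg_basisVec_one {d : ℕ} (u : Word d) :
    leftReg (u : WithZero (Word d)) (basisVec 1) = basisVec u := by
  rw [leftReg_basisVec, mul_one]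

section

variable {d : ℕ} {J : Submodule ℂ (Op (Fock d))}

theorem apply_eq_zero_of_leftReg_mem {u : Word d}
    (h : leftReg (u : WithZero (Word d)) ∈ J) {f : Fock d} (hf : f ∈ coinvariant J) : f u = 0 := by
  have h1 := mem_coinvariant_iff.1 hf _ h
  rwa [leftReg_basisVec_one, inner_basisVec_right, map_eq_zero] at h1

theorem leftReg_mem_of_forall_apply_eq_zero (hJ : IsHomogeneous J) {u : Word d}
    (h : ∀ f ∈ coinvariant J, f u = 0) : leftReg (u : WithZero (Word d)) ∈ J := by
  refine mem_of_inner_coinvariant_eq_zero hJ (n := u.length)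
    (Submodule.subset_span ⟨u, rfl, rfl⟩) fun f hf => ?_
  rw [leftReg_basisVec_one, inner_basisVec_right, h f hf, map_zero]

theorem idealCon_eq_zero_iff (hJ : IsHomogeneousHopfIdeal J) (u : Word d) :
    ((u : WithZero (Word d)) : (idealCon J hJ.isIdeal).Quotient) =
      ((0 : WithZero (Word d)) : (idealCon J hJ.isIdeal).Quotient) ↔
      ∀ f ∈ coinvariant J, f u = 0 := by
  rw [Con.eq]
  change leftReg (u : WithZero (Word d)) - 0 ∈ J ↔ _
  rw [sub_zero]
  exact ⟨fun h f hf => apply_eq_zero_of_leftReg_mem h hf,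
    leftReg_mem_of_forall_apply_eq_zero hJ.isHomogeneous⟩

theorem idealCon_eq_iff (hJ : IsHomogeneousHopfIdeal J) (u v : Word d) :
    ((u : WithZero (Word d)) : (idealCon J hJ.isIdeal).Quotient) =
      ((v : WithZero (Word d)) : (idealCon J hJ.isIdeal).Quotient) ↔
      ∀ f ∈ coinvariant J, f u = f v := by
  rw [Con.eq]
  change leftReg (u : WithZero (Word d)) - leftReg (v : WithZero (Word d)) ∈ J ↔ _
  have hdiff : ∀ f : Fock d, inner ℂ f ((leftReg (u : WithZero (Word d)) -
      leftReg (v : WithZero (Word d))) (basisVec 1)) = starRingEnd ℂ (f u - f v) := by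
    intro f
    rw [_root_.sub_apply, leftReg_basisVec_one, leftReg_basisVec_one, inner_sub_right,
      inner_basisVec_right, inner_basisVec_right, map_sub]
  constructor
  · intro h f hf
    have h1 := mem_coinvariant_iff.1 hf _ h
    rw [hdiff, map_eq_zero] at h1
    exact sub_eq_zero.1 h1
  · intro h
    by_cases hl : v.length = u.length
    · refine mem_of_inner_coinvariant_eq_zero hJ.isHomogeneous (n := u.length)
        (Submodule.sub_mem _ (Submodule.subset_span ⟨u, rfl, rfl⟩)
          (Submodule.subset_span ⟨v, hl, rfl⟩)) fun f hf => ?_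
      rw [hdiff, h f hf, sub_self, map_zero]
    -- For words of different lengths `L_u - L_v` is not homogeneous. The component of `f` of degree
    -- `|u|` keeps the value at `u` and vanishes at `v`, so `f u = 0`, and likewise `f v = 0`: both
    -- operators lie in `J`.
    · refine Submodule.sub_mem _
        (leftReg_mem_of_forall_apply_eq_zero hJ.isHomogeneous fun f hf => ?_)
        (leftReg_mem_of_forall_apply_eq_zero hJ.isHomogeneous fun f hf => ?_)
      · have := h _ (homogProj_mem_coinvariant hJ.isHomogeneous u.length hf)
        rwa [homogProj_apply_eq f rfl, homogProj_apply_ne f hl] at this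
      · have := h _ (homogProj_mem_coinvariant hJ.isHomogeneous v.length hf)
        rw [homogProj_apply_eq f rfl, homogProj_apply_ne f (Ne.symm hl)] at this
        exact this.symm

/-! ### Separating the classes by functions in `N_J` -/

/-- For a word `u` outside the zero class, some homogeneous vector of `N_J` takes the value `1` at
`u`. -/
theorem exists_homogeneous_apply_eq_one (hJ : IsHomogeneousHopfIdeal J) {u : Word d}
    (hu : ((u : WithZero (Word d)) : (idealCon J hJ.isIdeal).Quotient) ≠
      ((0 : WithZero (Word d)) : (idealCon J hJ.isIdeal).Quotient)) :
    ∃ f ∈ coinvariant J, (∀ w : Word d, w.length ≠ u.length → f w = 0) ∧ f u = 1 := by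
  rw [Ne, idealCon_eq_zero_iff hJ] at hu
  push Not at hu
  obtain ⟨f, hf, hfu⟩ := hu
  refine ⟨(f u)⁻¹ • homogProj u.length f, Submodule.smul_mem _ _
    (homogProj_mem_coinvariant hJ.isHomogeneous _ hf), fun w hw => ?_, ?_⟩
  · rw [lp.coeFn_smul, Pi.smul_apply, homogProj_apply_ne f hw, smul_zero]
  · rw [lp.coeFn_smul, Pi.smul_apply, homogProj_apply_eq f rfl, smul_eq_mul, inv_mul_cancel₀ hfu]

theorem length_eq_of_idealCon_eq (hJ : IsHomogeneousHopfIdeal J) {u v : Word d}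
    (hu : ((u : WithZero (Word d)) : (idealCon J hJ.isIdeal).Quotient) ≠
      ((0 : WithZero (Word d)) : (idealCon J hJ.isIdeal).Quotient))
    (huv : ((v : WithZero (Word d)) : (idealCon J hJ.isIdeal).Quotient) =
      ((u : WithZero (Word d)) : (idealCon J hJ.isIdeal).Quotient)) : v.length = u.length := by
  obtain ⟨f, hf, hdeg, hfu⟩ := exists_homogeneous_apply_eq_one hJ hu
  by_contra hl
  have := (idealCon_eq_iff hJ v u).1 huv f hf
  rw [hdeg v hl, hfu] at this
  exact zero_ne_one this

theorem exists_coe_eq (hJ : IsIdeal J) (s : NonzeroElt (idealCon J hJ)) :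
    ∃ u : Word d, ((u : WithZero (Word d)) : (idealCon J hJ).Quotient) = s.1 := by
  obtain ⟨s, hs⟩ := s
  obtain ⟨w, rfl⟩ := Con.mk'_surjective (c := idealCon J hJ) s
  have hw : w ≠ 0 := by rintro rfl; exact hs rfl
  obtain ⟨u, rfl⟩ := WithZero.ne_zero_iff_exists.1 hw
  exact ⟨u, rfl⟩

theorem finite_classOf (hJ : IsHomogeneousHopfIdeal J)
    (s : NonzeroElt (idealCon J hJ.isIdeal)) :
    (classOf (idealCon J hJ.isIdeal) s.1).Finite := by
  obtain ⟨u, hu⟩ := exists_coe_eq hJ.isIdeal s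
  have hu0 := s.2
  rw [← hu] at hu0
  refine ((finite_setOf_length_eq d u.length).image WithZero.coe).subset ?_
  intro w hw
  have hw' : (w : (idealCon J hJ.isIdeal).Quotient) = s.1 := hw
  induction w using WithZero.recZeroCoe with
  | zero => exact absurd hw'.symm s.2
  | coe v => exact ⟨v, length_eq_of_idealCon_eq hJ hu0 (hw'.trans hu.symm), rfl⟩

/-- Words in different classes are separated by homogeneous vectors of `N_J`. -/
theorem exists_homogeneous_separating (hJ : IsHomogeneousHopfIdeal J) {u v : Word d}
    (hu : ((u : WithZero (Word d)) : (idealCon J hJ.isIdeal).Quotient) ≠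
      ((0 : WithZero (Word d)) : (idealCon J hJ.isIdeal).Quotient))
    (huv : ((v : WithZero (Word d)) : (idealCon J hJ.isIdeal).Quotient) ≠
      ((u : WithZero (Word d)) : (idealCon J hJ.isIdeal).Quotient)) :
    ∃ f ∈ coinvariant J, (∀ w : Word d, w.length ≠ u.length → f w = 0) ∧ f u = 1 ∧ f v = 0 := by
  obtain ⟨f, hf, hdeg, hfu⟩ := exists_homogeneous_apply_eq_one hJ hu
  have hsupp : ∀ w ∉ wordsOfLength d u.length, f w = 0 := fun w hw =>
    hdeg w fun h => hw (mem_wordsOfLength.2 h)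
  -- If `f v = f u = 1`, no polynomial in `f` can separate the two words, and a second function `g`
  -- with `g u ≠ g v` is brought in, corrected by a multiple of `f` to vanish at `v`.
  by_cases hfv : f v = 1
  · have hlv : v.length = u.length := by
      by_contra hl
      rw [hdeg v hl] at hfv
      exact zero_ne_one hfv
    rw [Ne, idealCon_eq_iff hJ] at huv
    push Not at huv
    obtain ⟨g, hg, hguv⟩ := huv
    have hne : g u - g v ≠ 0 := sub_ne_zero.2 (Ne.symm hguv)
    refine ⟨(g u - g v)⁻¹ • (homogProj u.length g - g v • f), Submodule.smul_mem _ _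
      (Submodule.sub_mem _ (homogProj_mem_coinvariant hJ.isHomogeneous _ hg)
        (Submodule.smul_mem _ _ hf)), fun w hw => ?_, ?_, ?_⟩ <;>
    simp only [lp.coeFn_smul, lp.coeFn_sub, Pi.smul_apply, Pi.sub_apply, smul_eq_mul]
    · rw [homogProj_apply_ne g hw, hdeg w hw]
      ring
    · rw [homogProj_apply_eq g rfl, hfu, mul_one, inv_mul_cancel₀ hne]
    · rw [homogProj_apply_eq g hlv, hfv]
      ring
  -- Here `f² - f(v) f` vanishes at `v` and equals `1 - f(v) ≠ 0` at `u`.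
  · obtain ⟨h, hh, hmul⟩ := exists_mul_mem_coinvariant hJ.isCoideal _ hf hf hsupp hsupp
    have hne : 1 - f v ≠ 0 := sub_ne_zero.2 (Ne.symm hfv)
    refine ⟨(1 - f v)⁻¹ • (h - f v • f), Submodule.smul_mem _ _
      (Submodule.sub_mem _ hh (Submodule.smul_mem _ _ hf)), fun w hw => ?_, ?_, ?_⟩ <;>
    simp only [lp.coeFn_smul, lp.coeFn_sub, Pi.smul_apply, Pi.sub_apply, smul_eq_mul, hmul]
    · rw [hdeg w hw]
      ring
    · rw [hfu, mul_one, mul_one, inv_mul_cancel₀ hne]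
    · ring

open Classical in
/-- The indicator functions of the nonzero classes belong to `N_J`. -/
theorem exists_indicator_mem_coinvariant (hJ : IsHomogeneousHopfIdeal J)
    (s : NonzeroElt (idealCon J hJ.isIdeal)) :
    ∃ f ∈ coinvariant J, ∀ w : Word d, f w =
      if ((w : WithZero (Word d)) : (idealCon J hJ.isIdeal).Quotient) = s.1 then 1 else 0 := by
  obtain ⟨u, hus⟩ := exists_coe_eq hJ.isIdeal s
  have hu := s.2
  rw [← hus] at hu ⊢
  -- A product of separating functions, one for each word of `T`. Applied to the finitely many words
  -- of length `|u|` outside the class of `u`, it yields the indicator.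
  have key : ∀ T : Finset (Word d),
      (∀ v ∈ T, ((v : WithZero (Word d)) : (idealCon J hJ.isIdeal).Quotient) ≠
        ((u : WithZero (Word d)) : (idealCon J hJ.isIdeal).Quotient)) →
      ∃ f ∈ coinvariant J, (∀ w : Word d, w.length ≠ u.length → f w = 0) ∧ f u = 1 ∧
        ∀ v ∈ T, f v = 0 := by
    intro T
    induction T using Finset.induction_on with
    | empty =>
      intro _
      obtain ⟨f, hf, hdeg, hfu⟩ := exists_homogeneous_apply_eq_one hJ hu
      exact ⟨f, hf, hdeg, hfu, by simp⟩
    | insert v T _ ih =>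
      intro hT
      obtain ⟨f, hf, hdeg, hfu, hfT⟩ := ih fun w hw => hT w (Finset.mem_insert_of_mem hw)
      obtain ⟨g, hg, hgdeg, hgu, hgv⟩ :=
        exists_homogeneous_separating hJ hu (hT v (Finset.mem_insert_self v T))
      obtain ⟨h, hh, hmul⟩ := exists_mul_mem_coinvariant hJ.isCoideal (wordsOfLength d u.length)
        hf hg (fun w hw => hdeg w fun h => hw (mem_wordsOfLength.2 h))
        (fun w hw => hgdeg w fun h => hw (mem_wordsOfLength.2 h))
      refine ⟨h, hh, fun w hw => by rw [hmul, hdeg w hw, zero_mul], by rw [hmul, hfu, hgu, one_mul],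
        fun w hw => ?_⟩
      rw [hmul]
      rcases Finset.mem_insert.1 hw with rfl | hw
      · rw [hgv, mul_zero]
      · rw [hfT w hw, zero_mul]
  obtain ⟨f, hf, hdeg, hfu, hfT⟩ := key ((wordsOfLength d u.length).filter fun v =>
    ((v : WithZero (Word d)) : (idealCon J hJ.isIdeal).Quotient) ≠
      ((u : WithZero (Word d)) : (idealCon J hJ.isIdeal).Quotient))
    fun v hv => (Finset.mem_filter.1 hv).2
  refine ⟨f, hf, fun w => ?_⟩
  split_ifs with hw
  · rw [(idealCon_eq_iff hJ w u).1 hw f hf, hfu]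
  · by_cases hl : w.length = u.length
    · exact hfT w (Finset.mem_filter.2 ⟨mem_wordsOfLength.2 hl, hw⟩)
    · exact hdeg w hl

end

/-! ### The unitary `N_J → H[S]` -/

theorem exists_finset_classOf {d : ℕ} (c : Con (WithZero (Word d))) (s : NonzeroElt c)
    (hs : (classOf c s.1).Finite) : ∃ F : Finset (Word d),
      (∀ u : Word d, u ∈ F ↔ ((u : WithZero (Word d)) : c.Quotient) = s.1) ∧
      F.card = (classOf c s.1).ncard ∧ F.Nonempty := by
  obtain ⟨_, _, -, h⟩ := exists_averaging c
  obtain ⟨F, h1, h2, h3, -⟩ := h s hs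
  exact ⟨F, h1, h2, h3⟩

open Classical in
theorem xVec_apply {d : ℕ} (c : Con (WithZero (Word d))) (s : c.Quotient) (t : NonzeroElt c) :
    xVec c s t = if s = t.1 then (((Real.sqrt ((classOf c t.1).ncard))⁻¹ : ℝ) : ℂ) else 0 := by
  by_cases hs : s ≠ ((0 : WithZero (Word d)) : c.Quotient)
  · rw [xVec, dif_pos hs, lp.coeFn_smul, Pi.smul_apply, smul_eq_mul]
    split_ifs with h
    · subst h
      rw [basisVec_apply_self, mul_one]
    · rw [basisVec_apply_ne, mul_zero]
      rintro rfl
      exact h rfl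
  · rw [xVec, dif_neg hs, if_neg]
    · rfl
    · rintro rfl
      exact hs t.2

section

variable {d : ℕ} {J : Submodule ℂ (Op (Fock d))}

/-- There is a unitary `U : N_J → H[S]` with `U P_N ξ_u = x_u` for all words `u`. -/
theorem exists_unitary (hJ : IsHomogeneousHopfIdeal J) :
    ∃ U : coinvariant J ≃ₗᵢ[ℂ] SemigroupSpace (idealCon J hJ.isIdeal), ∀ u : Word d,
      U ((coinvariant J).orthogonalProjectionOnto (basisVec u)) =
        xVec (idealCon J hJ.isIdeal)
          ((u : WithZero (Word d)) : (idealCon J hJ.isIdeal).Quotient) := by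
  classical
  set c := idealCon J hJ.isIdeal with hc
  choose F hF hFcard hFne using fun s : NonzeroElt c =>
    exists_finset_classOf c s (finite_classOf hJ s)
  choose f hfN hf using fun s : NonzeroElt c => exists_indicator_mem_coinvariant hJ s
  let a : NonzeroElt c → ℝ := fun s => (Real.sqrt ((classOf c s.1).ncard))⁻¹
  have ha : ∀ s, a s * a s * (F s).card = 1 := by
    intro s
    have hpos : ((F s).card : ℝ) ≠ 0 := by exact_mod_cast (hFne s).card_pos.ne'
    rw [← mul_inv, Real.mul_self_sqrt (Nat.cast_nonneg _), ← hFcard s, inv_mul_cancel₀ hpos]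
  have ha0 : ∀ s, (a s : ℂ) ≠ 0 := by
    intro s h
    have h0 : a s = 0 := by exact_mod_cast h
    have := ha s
    rw [h0] at this
    simp at this
  have hinner : ∀ s (g : Fock d), inner ℂ (f s) g = ∑ u ∈ F s, g u := by
    intro s g
    rw [inner_eq_sum_of_support_left (F s) (f s) g fun w hw => by
      rw [hf, if_neg fun h => hw ((hF s w).2 h)]]
    refine Finset.sum_congr rfl fun u hu => ?_
    rw [hf, if_pos ((hF s u).1 hu), map_one, one_mul]
  let e : NonzeroElt c → coinvariant J := fun s => (a s : ℂ) • ⟨f s, hfN s⟩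
  have heinner : ∀ s (g : coinvariant J),
      inner ℂ (e s) g = a s * ∑ u ∈ F s, (g : Fock d) u := by
    intro s g
    change inner ℂ ((a s : ℂ) • f s) (g : Fock d) = _
    rw [inner_smul_left, Complex.conj_ofReal, hinner]
  have heapply : ∀ s (u : Word d), (e s : Fock d) u = if
      ((u : WithZero (Word d)) : c.Quotient) = s.1 then (a s : ℂ) else 0 := by
    intro s u
    change ((a s : ℂ) • f s : Fock d) u = _
    rw [lp.coeFn_smul, Pi.smul_apply, hf, smul_eq_mul, mul_ite, mul_one, mul_zero]
  have horth : Orthonormal ℂ e := by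
    rw [orthonormal_iff_ite]
    intro s t
    rw [heinner]
    split_ifs with hst
    · subst hst
      rw [Finset.sum_congr rfl fun u hu => by rw [heapply, if_pos ((hF s u).1 hu)],
        Finset.sum_const, nsmul_eq_mul]
      have := ha s
      rw [mul_assoc, mul_comm (a s) (F s).card] at this
      exact_mod_cast this
    · rw [Finset.sum_eq_zero, mul_zero]
      intro u hu
      rw [heapply, if_neg]
      intro h
      exact hst (Subtype.ext (((hF s u).1 hu).symm.trans h))
  -- A vector of `N` is constant on classes and vanishes on the zero class; orthogonality to `e s`
  -- makes its sum over the finite class `[s]` zero, hence its value there.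
  have hbot : (Submodule.span ℂ (Set.range e))ᗮ = ⊥ := by
    rw [Submodule.eq_bot_iff]
    intro g hg
    refine Subtype.ext (ext_coord fun u => ?_)
    by_cases hu : ((u : WithZero (Word d)) : c.Quotient) = ((0 : WithZero (Word d)) : c.Quotient)
    · exact (idealCon_eq_zero_iff hJ u).1 hu g g.2
    · let s : NonzeroElt c := ⟨_, hu⟩
      have h1 : inner ℂ (e s) g = 0 :=
        (Submodule.mem_orthogonal _ _).1 hg _ (Submodule.subset_span ⟨s, rfl⟩)
      have h2 : ∑ v ∈ F s, (g : Fock d) v = (F s).card * (g : Fock d) u := by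
        rw [Finset.sum_congr rfl fun v hv =>
          (idealCon_eq_iff hJ v u).1 ((hF s v).1 hv) g g.2, Finset.sum_const, nsmul_eq_mul]
      rw [heinner, h2, mul_eq_zero, or_iff_right (ha0 s), mul_eq_zero, or_iff_right] at h1
      · exact h1
      · exact_mod_cast (hFne s).card_pos.ne'
  let b := HilbertBasis.mkOfOrthogonalEqBot horth hbot
  have hb : ∀ s, b s = e s := fun s => by
    simp only [b, HilbertBasis.coe_mkOfOrthogonalEqBot]
  -- The coordinate of `P_N ξ_u` at `t` is `⟪e t, ξ_u⟫`, the conjugate of the value of `e t` at `u`,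
  -- which matches the coordinate of `x_u`.
  refine ⟨b.repr, fun u => ext_coord fun t => ?_⟩
  rw [HilbertBasis.repr_apply_apply, hb, xVec_apply,
    Submodule.inner_orthogonalProjectionOnto_eq_of_mem_left, inner_basisVec_right, heapply]
  split_ifs
  · exact Complex.conj_ofReal _
  · exact map_zero _

/-! ### Compressions to the coinvariant subspace -/

/-- Images under maps given by matrix coefficients are compatible with closures in the weak
operator topology. -/
theorem map_mem_wotClosure {H K : Type} [NormedAddCommGroup H] [InnerProductSpace ℂ H]
    [CompleteSpace H] [NormedAddCommGroup K] [InnerProductSpace ℂ K] [CompleteSpace K]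
    (Φ : Op H → Op K) (hΦ : ∀ x y : K, ∃ x' y' : H, ∀ A, inner ℂ y (Φ A x) = inner ℂ y' (A x'))
    {s : Set (Op H)} {t : Set (Op K)} (hst : ∀ A ∈ s, Φ A ∈ t) {A : Op H}
    (hA : A ∈ wotClosure s) : Φ A ∈ wotClosure t := by
  let Ψ : (H →WOT[ℂ] H) → (K →WOT[ℂ] K) := fun T =>
    ContinuousLinearMapWOT.ofCLM (Φ T.toCLM)
  have hΨ : Continuous Ψ := by
    rw [ContinuousLinearMapWOT.continuous_iff]
    intro x y
    obtain ⟨x', y', h⟩ := hΦ x y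
    refine (ContinuousLinearMapWOT.continuous_inner_apply continuous_id x' y').congr fun T => ?_
    exact (h T.toCLM).symm
  change Ψ (ContinuousLinearMapWOT.ofCLM A) ∈ closure _
  refine map_mem_closure hΨ hA ?_
  rintro _ ⟨B, hB, rfl⟩
  exact ⟨Φ B, hst B hB, rfl⟩

theorem inner_compress {H : Type} [NormedAddCommGroup H] [InnerProductSpace ℂ H]
    (N : Submodule ℂ H) [CompleteSpace N] (A : Op H) (x y : N) :
    inner ℂ y (compress N A x) = inner ℂ (y : H) (A x) :=
  Submodule.inner_orthogonalProjectionOnto_eq_of_mem_left _ _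

/-- `J ξ_∅` is invariant under `A` because `J` is a left ideal. -/
theorem adjoint_mem_coinvariant (hJ : IsIdeal J) {A : Op (Fock d)} (hA : A ∈ freeAlg d)
    {f : Fock d} (hf : f ∈ coinvariant J) :
    ContinuousLinearMap.adjoint A f ∈ coinvariant J := by
  rw [mem_coinvariant_iff] at hf ⊢
  intro B hB
  rw [ContinuousLinearMap.adjoint_inner_left]
  exact hf _ (hJ.mul_left A hA B hB)

/-- Here the right ideal property enters: `R_v B ξ_∅ = B ξ_v = (B L_v) ξ_∅` for `B ∈ J`. -/
theorem adjoint_rightReg_mem_coinvariant (hJ : IsIdeal J) (v : Word d)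
    {f : Fock d} (hf : f ∈ coinvariant J) :
    ContinuousLinearMap.adjoint (rightReg v) f ∈ coinvariant J := by
  rw [mem_coinvariant_iff] at hf ⊢
  intro B hB
  rw [ContinuousLinearMap.adjoint_inner_left,
    ← apply_basisVec_of_commute (mem_freeAlg_iff.1 (hJ.subset hB)) v, ← leftReg_basisVec_one]
  exact hf _ (hJ.mul_right _ (leftReg_mem_freeAlg v) B hB)

/-- If `A*` leaves `N` invariant then `P_N A = P_N A P_N`. -/
theorem proj_apply_proj {H : Type} [NormedAddCommGroup H] [InnerProductSpace ℂ H]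
    [CompleteSpace H] (N : Submodule ℂ H) [CompleteSpace N] {A : Op H}
    (hA : ∀ f ∈ N, ContinuousLinearMap.adjoint A f ∈ N) (x : H) :
    N.orthogonalProjectionOnto (A (N.orthogonalProjectionOnto x)) =
      N.orthogonalProjectionOnto (A x) := by
  refine ext_inner_left ℂ fun y => ?_
  rw [Submodule.inner_orthogonalProjectionOnto_eq_of_mem_left,
    Submodule.inner_orthogonalProjectionOnto_eq_of_mem_left,
    ← ContinuousLinearMap.adjoint_inner_left A, ← ContinuousLinearMap.adjoint_inner_left A]
  exact Submodule.inner_orthogonalProjectionOnto_eq_of_mem_left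
    (⟨_, hA y y.2⟩ : N) x

theorem compress_mul {H : Type} [NormedAddCommGroup H] [InnerProductSpace ℂ H]
    [CompleteSpace H] (N : Submodule ℂ H) [CompleteSpace N] {A : Op H}
    (hA : ∀ f ∈ N, ContinuousLinearMap.adjoint A f ∈ N) (B : Op H) :
    compress N (A * B) = compress N A * compress N B := by
  ext1 x
  exact (proj_apply_proj N hA (B x)).symm

theorem rightReg_mul (v w : Word d) : rightReg (v * w) = rightReg w * rightReg v := by
  apply op_ext_basisVec
  intro u
  change _ = rightReg w (rightReg v (basisVec u))
  rw [rightReg_basisVec, rightReg_basisVec, rightReg_basisVec, mul_assoc]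

theorem rightReg_one : rightReg (1 : Word d) = 1 := by
  apply op_ext_basisVec
  intro u
  rw [rightReg_basisVec, mul_one]
  rfl

theorem mem_freeAlg_of_commute_of {A : Op (Fock d)}
    (hA : ∀ i, A * rightReg (FreeMonoid.of i) = rightReg (FreeMonoid.of i) * A) :
    A ∈ freeAlg d := by
  rw [mem_freeAlg_iff]
  intro v
  induction v using FreeMonoid.inductionOn' with
  | one => rw [rightReg_one, mul_one, one_mul]
  | of_mul i v ih => rw [rightReg_mul, ← mul_assoc, ih, mul_assoc, hA, mul_assoc]

/-- Commutant lifting: an operator on `N_J` which commutes with the compressions of the right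
regular representation is the compression of an element of `𝓛_d`. -/
theorem mem_compressionAlg_of_commute (hJ : IsIdeal J) {T : Op (coinvariant J)}
    (hT : ∀ v, T * compress (coinvariant J) (rightReg v) =
      compress (coinvariant J) (rightReg v) * T) : T ∈ compressionAlg J := by
  have hadj : ∀ i (x : coinvariant J),
      ContinuousLinearMap.adjoint (compress (coinvariant J) (rightReg (FreeMonoid.of i))) x =
        ⟨rightAnn i x, adjoint_rightReg_mem_coinvariant hJ _ x.2⟩ := by
    intro i x
    refine ext_inner_right ℂ fun y => ?_
    rw [ContinuousLinearMap.adjoint_inner_left, inner_compress]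
    exact (ContinuousLinearMap.adjoint_inner_left _ _ _).symm
  -- The compression of `Rᵢ` has as adjoint the restriction of `aᵢ` to `N`, so `T*` commutes with
  -- these restrictions and extends to some `Y` on the Fock space. Then `Y*` commutes with all `Rᵢ`,
  -- and its compression is `T` because `Y` restricts to `T*`.
  obtain ⟨Y, hYX, hY⟩ := exists_intertwining_extension (coinvariant J)
    ((coinvariant J).subtypeL ∘L ContinuousLinearMap.adjoint T)
    (fun i x hx => adjoint_rightReg_mem_coinvariant hJ _ hx) (fun i x => by
      have h1 := congrArg ContinuousLinearMap.adjoint (hT (FreeMonoid.of i))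
      rw [ContinuousLinearMap.mul_def, ContinuousLinearMap.mul_def,
        ContinuousLinearMap.adjoint_comp, ContinuousLinearMap.adjoint_comp] at h1
      have h2 := congrArg (fun S : Op (coinvariant J) => ((S x : coinvariant J) : Fock d)) h1
      simp only [ContinuousLinearMap.comp_apply, hadj] at h2
      exact h2.symm)
  refine ⟨ContinuousLinearMap.adjoint Y, mem_freeAlg_of_commute_of fun i => ?_, ?_⟩
  · ext1 x
    refine ext_inner_right ℂ fun y => ?_
    change inner ℂ (ContinuousLinearMap.adjoint Y (rightReg (FreeMonoid.of i) x)) y =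
      inner ℂ (rightReg (FreeMonoid.of i) (ContinuousLinearMap.adjoint Y x)) y
    rw [ContinuousLinearMap.adjoint_inner_left,
      ← ContinuousLinearMap.adjoint_inner_right (rightReg (FreeMonoid.of i)),
      ← ContinuousLinearMap.adjoint_inner_right (rightReg (FreeMonoid.of i)),
      ContinuousLinearMap.adjoint_inner_left]
    exact congrArg _ (hY i y).symm
  · ext1 x
    refine ext_inner_left ℂ fun y => ?_
    rw [inner_compress, ContinuousLinearMap.adjoint_inner_right, hYX,
      ← ContinuousLinearMap.adjoint_inner_left T]
    rfl

theorem compress_leftReg_commute (hJ : IsIdeal J) (u v : Word d) :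
    compress (coinvariant J) (leftReg (u : WithZero (Word d))) *
        compress (coinvariant J) (rightReg v) =
      compress (coinvariant J) (rightReg v) *
        compress (coinvariant J) (leftReg (u : WithZero (Word d))) := by
  have h1 := compress_mul (coinvariant J) (A := leftReg (u : WithZero (Word d)))
    (fun f hf => adjoint_mem_coinvariant hJ (leftReg_mem_freeAlg (u : WithZero (Word d))) hf)
    (rightReg v)
  have h2 := compress_mul (coinvariant J) (A := rightReg v)
    (fun f hf => adjoint_rightReg_mem_coinvariant hJ v hf) (leftReg (u : WithZero (Word d)))
  rw [← h1, ← h2, leftReg_commute_rightReg]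

/-! ### Unitary equivalence -/

/-- Operators on `H[S]` which agree on the vectors `x_u`, `u` a word, are equal. -/
theorem op_ext_xVec (c : Con (WithZero (Word d)))
    (hc : ∀ s : NonzeroElt c, (classOf c s.1).Finite) {S T : Op (SemigroupSpace c)}
    (h : ∀ u : Word d, S (xVec c ((u : WithZero (Word d)) : c.Quotient)) =
      T (xVec c ((u : WithZero (Word d)) : c.Quotient))) : S = T := by
  apply op_ext_basisVec
  intro t
  obtain ⟨F, hF, hcard, u, hu⟩ := exists_finset_classOf c t (hc t)
  -- Finiteness is essential: an infinite class has `ncard` equal to `0`, and its `x`-vector would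
  -- vanish.
  have hne : (((Real.sqrt ((classOf c t.1).ncard))⁻¹ : ℝ) : ℂ) ≠ 0 := by
    rw [← hcard]
    have hpos : (0 : ℝ) < F.card := by exact_mod_cast Finset.card_pos.2 ⟨u, hu⟩
    exact_mod_cast (inv_pos.2 (Real.sqrt_pos.2 hpos)).ne'
  have hx := h u
  rw [(hF u).1 hu, xVec, dif_pos t.2, map_smul, map_smul] at hx
  exact smul_right_injective _ hne hx

/-- The operators `weightedLeftReg` are chosen through their values on the `x_t`; finite classes
make this choice unique. The zero class needs its own treatment since it may contain no word. -/
theorem weightedLeftReg_zero (c : Con (WithZero (Word d)))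
    (hc : ∀ s : NonzeroElt c, (classOf c s.1).Finite) :
    weightedLeftReg c ((0 : WithZero (Word d)) : c.Quotient) = 0 := by
  refine op_ext_xVec c hc fun u => ?_
  rw [weightedLeftReg_xVec, ← Con.coe_mul, zero_mul, xVec_zero]
  rfl

/-! ### Conjugation by a unitary -/

section Conj

variable {H K : Type} [NormedAddCommGroup H] [InnerProductSpace ℂ H] [CompleteSpace H]
  [NormedAddCommGroup K] [InnerProductSpace ℂ K] [CompleteSpace K] (U : H ≃ₗᵢ[ℂ] K)

/-- The operator `U A U*`. -/
def conjOp (A : Op H) : Op K := U.conjStarAlgEquiv A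

theorem conjOp_apply (A : Op H) (x : K) : conjOp U A x = U (A (U.symm x)) :=
  LinearIsometryEquiv.conjStarAlgEquiv_apply_apply U A x

theorem conjOp_mul (A B : Op H) : conjOp U (A * B) = conjOp U A * conjOp U B :=
  map_mul U.conjStarAlgEquiv A B

theorem conjOp_add (A B : Op H) : conjOp U (A + B) = conjOp U A + conjOp U B :=
  map_add U.conjStarAlgEquiv A B

theorem conjOp_algebraMap (r : ℂ) : conjOp U (algebraMap ℂ (Op H) r) = algebraMap ℂ (Op K) r :=
  AlgHomClass.commutes U.conjStarAlgEquiv r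

theorem conjOp_injective : Function.Injective (conjOp U) := U.conjStarAlgEquiv.injective

theorem conjOp_surjective : Function.Surjective (conjOp U) := U.conjStarAlgEquiv.surjective

theorem inner_conjOp (A : Op H) (x y : K) :
    inner ℂ y (conjOp U A x) = inner ℂ (U.symm y) (A (U.symm x)) := by
  rw [conjOp_apply, ← LinearIsometryEquiv.inner_map_map U, LinearIsometryEquiv.apply_symm_apply]

end Conj

theorem compress_add {H : Type} [NormedAddCommGroup H] [InnerProductSpace ℂ H]
    (N : Submodule ℂ H) [CompleteSpace N] (A B : Op H) :
    compress N (A + B) = compress N A + compress N B := by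
  ext1 x
  exact map_add N.orthogonalProjectionOnto (A x) (B x)

theorem compress_algebraMap {H : Type} [NormedAddCommGroup H] [InnerProductSpace ℂ H]
    (N : Submodule ℂ H) [CompleteSpace N] (r : ℂ) :
    compress N (algebraMap ℂ (Op H) r) = algebraMap ℂ (Op N) r := by
  ext1 x
  refine ext_inner_left ℂ fun y => ?_
  rw [inner_compress]
  simp only [Algebra.algebraMap_eq_smul_one]
  rfl

/-- Since `P_N L_u P_N = P_N L_u` and `U P_N ξ_w = x_w`, both operators send `x_v` to `x_{uv}`. -/
theorem conjOp_compress_leftReg (hJ : IsHomogeneousHopfIdeal J)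
    (U : coinvariant J ≃ₗᵢ[ℂ] SemigroupSpace (idealCon J hJ.isIdeal))
    (hU : ∀ u : Word d, U ((coinvariant J).orthogonalProjectionOnto (basisVec u)) =
      xVec (idealCon J hJ.isIdeal)
        ((u : WithZero (Word d)) : (idealCon J hJ.isIdeal).Quotient)) (u : Word d) :
    conjOp U (compress (coinvariant J) (leftReg (u : WithZero (Word d)))) =
      weightedLeftReg (idealCon J hJ.isIdeal)
        ((u : WithZero (Word d)) : (idealCon J hJ.isIdeal).Quotient) := by
  refine op_ext_xVec _ (finite_classOf hJ) fun v => ?_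
  have h1 := proj_apply_proj (coinvariant J) (A := leftReg (u : WithZero (Word d)))
    (fun f hf => adjoint_mem_coinvariant hJ.isIdeal
      (leftReg_mem_freeAlg (u : WithZero (Word d))) hf) (basisVec v)
  rw [leftReg_basisVec] at h1
  have h2 : U.symm (xVec (idealCon J hJ.isIdeal)
      ((v : WithZero (Word d)) : (idealCon J hJ.isIdeal).Quotient)) =
      (coinvariant J).orthogonalProjectionOnto (basisVec v) := by
    rw [← hU v, LinearIsometryEquiv.symm_apply_apply]
  rw [conjOp_apply, h2]
  refine (congrArg U h1).trans ?_
  rw [hU, weightedLeftReg_xVec]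
  rfl

theorem conjOp_compress_mem_adjoin (hJ : IsHomogeneousHopfIdeal J)
    (U : coinvariant J ≃ₗᵢ[ℂ] SemigroupSpace (idealCon J hJ.isIdeal))
    (hU : ∀ u : Word d, U ((coinvariant J).orthogonalProjectionOnto (basisVec u)) =
      xVec (idealCon J hJ.isIdeal)
        ((u : WithZero (Word d)) : (idealCon J hJ.isIdeal).Quotient)) {A : Op (Fock d)}
    (hA : A ∈ Algebra.adjoin ℂ (Set.range fun u : Word d => leftReg (u : WithZero (Word d)))) :
    conjOp U (compress (coinvariant J) A) ∈
      Algebra.adjoin ℂ (Set.range (weightedLeftReg (idealCon J hJ.isIdeal))) := by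
  refine Algebra.adjoin_induction (p := fun A _ => conjOp U (compress (coinvariant J) A) ∈
      Algebra.adjoin ℂ (Set.range (weightedLeftReg (idealCon J hJ.isIdeal)))) ?_ ?_ ?_ ?_ hA
  · rintro _ ⟨u, rfl⟩
    rw [conjOp_compress_leftReg hJ U hU]
    exact Algebra.subset_adjoin (Set.mem_range_self _)
  · intro r
    rw [compress_algebraMap, conjOp_algebraMap]
    exact Subalgebra.algebraMap_mem _ r
  · intro A B _ _ h1 h2
    rw [compress_add, conjOp_add]
    exact Subalgebra.add_mem _ h1 h2
  · intro A B hA _ h1 h2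
    rw [compress_mul (coinvariant J)
      (fun f hf => adjoint_mem_coinvariant hJ.isIdeal (subset_wotClosure _ hA) hf) B, conjOp_mul]
    exact Subalgebra.mul_mem _ h1 h2

/-- One inclusion passes from polynomials to limits by WOT-continuity of compression. The other
avoids approximation: commuting with the transported compressions of the `R_v` is a WOT-closed
condition satisfied by the generators `L_s`, and commutant lifting turns it into membership in the
compression algebra. -/
theorem unitarilyEquivalent_compressionAlg (hJ : IsHomogeneousHopfIdeal J) :
    UnitarilyEquivalent (compressionAlg J) (semigroupAlg (idealCon J hJ.isIdeal)) := by
  obtain ⟨U, hU⟩ := exists_unitary hJ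
  refine ⟨U, Set.Subset.antisymm ?_ ?_⟩
  · rintro _ ⟨_, ⟨A, hA, rfl⟩, rfl⟩
    refine map_mem_wotClosure (fun A => conjOp U (compress (coinvariant J) A))
      (fun x y => ⟨U.symm x, U.symm y, fun A => ?_⟩)
      (fun A hA => conjOp_compress_mem_adjoin hJ U hU hA) hA
    rw [inner_conjOp, inner_compress]
  · intro T hT
    obtain ⟨T, rfl⟩ := conjOp_surjective U T
    refine ⟨T, mem_compressionAlg_of_commute hJ.isIdeal fun v => conjOp_injective U ?_, rfl⟩
    rw [conjOp_mul, conjOp_mul]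
    set R := conjOp U (compress (coinvariant J) (rightReg v)) with hR
    refine commute_of_mem_wotClosure (fun B hB => ?_) hT
    refine Algebra.adjoin_induction (p := fun B _ => B * R = R * B) ?_ ?_ ?_ ?_ hB
    · rintro _ ⟨s, rfl⟩
      obtain ⟨w, rfl⟩ := Con.mk'_surjective s
      induction w using WithZero.recZeroCoe with
      | zero =>
        have h0 := weightedLeftReg_zero _ (finite_classOf hJ)
        change weightedLeftReg _ ((0 : WithZero (Word d)) : (idealCon J hJ.isIdeal).Quotient) * R =
          R * weightedLeftReg _ ((0 : WithZero (Word d)) : (idealCon J hJ.isIdeal).Quotient)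
        rw [h0, zero_mul, mul_zero]
      | coe u =>
        change weightedLeftReg _ ((u : WithZero (Word d)) : (idealCon J hJ.isIdeal).Quotient) * R =
          R * weightedLeftReg _ ((u : WithZero (Word d)) : (idealCon J hJ.isIdeal).Quotient)
        rw [← conjOp_compress_leftReg hJ U hU, hR, ← conjOp_mul, ← conjOp_mul,
          compress_leftReg_commute hJ.isIdeal]
    · intro r
      exact Algebra.commutes r _
    · intro x y _ _ hx hy
      rw [add_mul, mul_add, hx, hy]
    · intro x y _ _ hx hy
      rw [mul_assoc, hy, ← mul_assoc, hx, mul_assoc]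

end

end FockAlg

end

theorem theorem3p6 (d : ℕ)
    (J : Submodule ℂ (FockAlg.Op (FockAlg.Fock d)))
    (hJ : FockAlg.IsHomogeneousHopfIdeal J) :
    (∀ s : FockAlg.NonzeroElt (FockAlg.idealCon J hJ.isIdeal),
      (FockAlg.classOf (FockAlg.idealCon J hJ.isIdeal) s.1).Finite) ∧
    FockAlg.UnitarilyEquivalent
      (FockAlg.compressionAlg J)
      (FockAlg.semigroupAlg (FockAlg.idealCon J hJ.isIdeal)) :=
  ⟨FockAlg.finite_classOf hJ, FockAlg.unitarilyEquivalent_compressionAlg hJ⟩
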